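/- Let $K\in\mathbb{C}$ with $\operatorname{Re}K>0$, $\operatorname{Im}K>0$. Let $\eta_{1,1},\eta_{2,1}=-\frac d2\mp\frac{i\sqrt{4-d^2}}2$ with $d=K^2-2$, and $\eta_{1,2},\eta_{2,2}=-\frac d2\pm\frac{\sqrt{d^2-4}}2$ with $d=K^2-6$. Let $\mathbf R$ be the compact Riemann surface (a torus) of $$\Upsilon(x)=\sqrt{(x-\eta_{1,1})(x-\eta_{1,2})(x-\eta_{2,1})(x-\eta_{2,2})},$$ a two-sheeted cover of the Riemann sphere $\overline{\mathbb C}$, branched exactly over the four points $\eta_{j,l}$, with two points over $\infty$. The image $x\in\overline{\mathbb C}$ of $\hat x\in\mathbf R$ is called its affix; the point of $\mathbf R$ over $\eta_{j,l}$ is again denoted by $\eta_{j,l}$. Local variables on $\mathbf R$ are $x-x_0$ at ordinary finite points, $\sqrt{x-\eta_{j,l}}$ at the branch points, and $1/x$ at the two points over $\infty$; orders of zeros and poles are taken in these variables. $\mathbf K_1$ is the field of meromorphic functions on $\mathbf R$. At a finite non-branch point, $\dot\Upsilon=d\Upsilon/dx$ and $\ddot\Upsilon=d^2\Upsilon/dx^2$.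 For $\hat b_1,\hat b_2,\hat a_1,\hat a_2\in\mathbf R$, a function $M(\hat b_1,\hat b_2,\hat a_1,\hat a_2;\hat x)$ is an $M\in\mathbf K_1$ whose poles are exactly $\hat b_1,\hat b_2$ (simple if $\hat b_1\ne\hat b_2$, one double pole if $\hat b_1=\hat b_2$) and whose zeros are exactly $\hat a_1,\hat a_2$ (simple if $\hat a_1\neq\hat a_2$, one double zero if $\hat a_1=\hat a_2$). In what follows $a_i,b_i,b$ are the affixes of $\hat a_i,\hat b_i,\hat b$. 1. Let $\eta=\eta_{j,l}$ be a branch point and $\hat a_1,\hat a_2\in\mathbf R$ (affixes may be infinite) such that, if $\hat a_1=\hat a_2$, this point is a branch point different from $\eta$. Then $M(\eta,\eta,\hat a_1,\hat a_2;\hat x)$ exists iff $a_1=a_2$. In that case $\frac{x-a_1}{x-\eta}$ (read as $\frac1{x-\eta}$ if $a_1=\infty$) is such a function, and every such function is a non-zero constant multiple of it. 2. Let $\hat b_1\neq\hat b_2$ have the same affix $b$, not equal to $\infty$ or to any branch point, and let $\eta=\eta_{j,l}$ be a branch point. Then $M(\hat b_1,\hat b_1,\hat b_2,\eta;\hat x)$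 exists iff $$\frac{\Upsilon(\hat b_1)}{(\eta-b)^2}+\frac{\dot\Upsilon(\hat b_1)}{\eta-b}+\frac{\ddot\Upsilon(\hat b_1)}2=0.$$ 3. Let $a_1,a_2,b_1,b_2$ be pairwise distinct and not equal to $\infty$ or to any branch point. Then $M(\hat b_1,\hat b_2,\hat a_1,\hat a_2;\hat x)$ exists iff $$\frac{\Upsilon(\hat a_2)}{(a_2-b_1)(a_2-b_2)}+\frac{\Upsilon(\hat b_1)}{(a_2-b_1)(b_1-b_2)}+\frac{\Upsilon(\hat b_2)}{(a_2-b_2)(b_2-b_1)}=\frac{\Upsilon(\hat a_1)}{(a_1-b_1)(a_1-b_2)}+\frac{\Upsilon(\hat b_1)}{(a_1-b_1)(b_1-b_2)}+\frac{\Upsilon(\hat b_2)}{(a_1-b_2)(b_2-b_1)}.$$ 4. Let $a_1\ne a_2$, $a_1\neq b$, $a_2\ne b$, with $a_1,a_2,b$ not equal to $\infty$ or to any branch point. Then $M(\hat b,\hat b,\hat a_1,\hat a_2;\hat x)$ exists iff $$\frac{\Upsilon(\hat a_1)}{(a_1-b)^2}+\frac{\Upsilon(\hat b)}{(a_1-b)^2}+\frac{\dot\Upsilon(\hat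 b)}{a_1-b}=\frac{\Upsilon(\hat a_2)}{(a_2-b)^2}+\frac{\Upsilon(\hat b)}{(a_2-b)^2}+\frac{\dot\Upsilon(\hat b)}{a_2-b}.$$ -/

import Mathlib

namespace DiscreteWedge

noncomputable section

/-- The branch points `η_{j,l}` (indices shifted to start at `0`): `η_{1,1}, η_{2,1}` are the roots of
`x² + d x + 1` with `d = K² - 2`, and `η_{1,2}, η_{2,2}` those of `x² + d x + 1` with `d = K² - 6`. -/
def eta (K : ℂ) (j l : Fin 2) : ℂ :=
  ![![-(K ^ 2 - 2) / 2 - Complex.I * Complex.sqrt (4 - (K ^ 2 - 2) ^ 2) / 2,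
      -(K ^ 2 - 6) / 2 + Complex.sqrt ((K ^ 2 - 6) ^ 2 - 4) / 2],
    ![-(K ^ 2 - 2) / 2 + Complex.I * Complex.sqrt (4 - (K ^ 2 - 2) ^ 2) / 2,
      -(K ^ 2 - 6) / 2 - Complex.sqrt ((K ^ 2 - 6) ^ 2 - 4) / 2]] j l

/-- The polynomial `f(x) = ∏ (x - η_{j,l})`, so that `Υ² = f`. -/
def quartic (K x : ℂ) : ℂ := ∏ j : Fin 2, ∏ l : Fin 2, (x - eta K j l)

theorem sqrt_sq (z : ℂ) : Complex.sqrt z ^ 2 = z := by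
  simp [Complex.sqrt]

/-- `Υ² = x² ((K² - 4 + x + 1/x)² - 4)`. -/
theorem quartic_eq (K x : ℂ) (hx : x ≠ 0) :
    quartic K x = x ^ 2 * ((K ^ 2 - 4 + x + x⁻¹) ^ 2 - 4) := by
  have h1 := sqrt_sq (4 - (K ^ 2 - 2) ^ 2)
  have h2 := sqrt_sq ((K ^ 2 - 6) ^ 2 - 4)
  have e1 : (x - eta K 0 0) * (x - eta K 1 0) = x ^ 2 + (K ^ 2 - 2) * x + 1 := by
    simp only [eta, Matrix.cons_val_zero, Matrix.cons_val_one]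
    linear_combination (-Complex.I ^ 2 / 4) * h1 + (-(4 - (K ^ 2 - 2) ^ 2) / 4) * Complex.I_sq
  have e2 : (x - eta K 0 1) * (x - eta K 1 1) = x ^ 2 + (K ^ 2 - 6) * x + 1 := by
    simp only [eta, Matrix.cons_val_zero, Matrix.cons_val_one]
    linear_combination (-1 / 4) * h2
  have e : quartic K x = (x ^ 2 + (K ^ 2 - 2) * x + 1) * (x ^ 2 + (K ^ 2 - 6) * x + 1) := by
    rw [← e1, ← e2]; simp only [quartic, Fin.prod_univ_two]; ring
  rw [e]; field_simp; ring

theorem quartic_eta (K : ℂ) (j l : Fin 2) : quartic K (eta K j l) = 0 := by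
  unfold quartic
  exact Finset.prod_eq_zero (Finset.mem_univ j)
    (Finset.prod_eq_zero (Finset.mem_univ l) (sub_self _))

/-- The points of the compact Riemann surface `R` of `Υ = √f`: the finite points are the pairs
`(x, υ)` with `υ² = f(x)`; over `x = ∞` there are the two points `inf ε`, `ε = ±1`, where
`inf ε` is the point at which `Υ / x² → ε`. -/
inductive Surface (K : ℂ) : Type
  | fin (x υ : ℂ) (h : υ ^ 2 = quartic K x) : Surface K
  | inf (ε : ℤˣ) : Surface K

/-- The projection of `R` to the Riemann sphere (the affix of a point). -/
def affix {K : ℂ} : Surface K → OnePoint ℂ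
  | .fin x _ _ => (x : OnePoint ℂ)
  | .inf _ => OnePoint.infty

/-- The point of `R` over the branch point `η_{j,l}`. -/
def branchPt (K : ℂ) (j l : Fin 2) : Surface K :=
  .fin (eta K j l) 0 (by rw [quartic_eta]; norm_num)

/-- The function `Υ` on `R` (its poles, the points at infinity, get the placeholder value `0`). -/
def upsilon {K : ℂ} : Surface K → ℂ
  | .fin _ υ _ => υ
  | .inf _ => 0

/-- A square root of `b` that depends analytically on `b` near `a`, if `a ≠ 0`. -/
def sqrtNear (a b : ℂ) : ℂ :=
  if a = 0 then Complex.sqrt b else Complex.sqrt a * Complex.sqrt (b / a)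

theorem sqrtNear_sq (a b : ℂ) : sqrtNear a b ^ 2 = b := by
  unfold sqrtNear
  split_ifs with h
  · exact sqrt_sq b
  · rw [mul_pow, sqrt_sq, sqrt_sq, mul_div_cancel₀ b h]

/-- Near an ordinary finite point `(x₀, υ₀)` the local variable is `τ = x - x₀`. -/
def paramRegular {K : ℂ} (x₀ υ₀ : ℂ) (h : υ₀ ^ 2 = quartic K x₀) (h0 : υ₀ ≠ 0) (τ : ℂ) :
    Surface K :=
  .fin (x₀ + τ) (υ₀ * Complex.sqrt (quartic K (x₀ + τ) / quartic K x₀)) (by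
    rw [mul_pow, sqrt_sq, h, mul_div_cancel₀]
    rw [← h]; exact pow_ne_zero 2 h0)

/-- Near a point over a branch point `η` the local variable is `τ = √(x - η)`, that is
`x = η + τ²` and `Υ = τ √(f(x) / (x - η))`. -/
def paramBranch {K : ℂ} (η : ℂ) (h : quartic K η = 0) (τ : ℂ) : Surface K :=
  .fin (η + τ ^ 2)
    (τ * sqrtNear (dslope (quartic K) η η) (dslope (quartic K) η (η + τ ^ 2))) (by
      have h1 := sub_smul_dslope (quartic K) η (η + τ ^ 2)
      rw [h, sub_zero, add_sub_cancel_left, smul_eq_mul] at h1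
      rw [mul_pow, sqrtNear_sq, h1])

/-- Near a point at infinity the local variable is `τ = 1 / x`, and `Υ = ε x² √(∏ (1 - η τ))`. -/
def paramInf {K : ℂ} (ε : ℤˣ) (τ : ℂ) : Surface K :=
  if hτ : τ = 0 then .inf ε
  else .fin τ⁻¹
    (((ε : ℤ) : ℂ) * (τ⁻¹) ^ 2 *
      Complex.sqrt (∏ j : Fin 2, ∏ l : Fin 2, (1 - eta K j l * τ))) (by
        have hε : (((ε : ℤ) : ℂ)) ^ 2 = 1 := by
          rcases Int.units_eq_one_or ε with rfl | rfl <;> norm_num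
        rw [mul_pow, mul_pow, sqrt_sq, hε]
        simp only [quartic, Fin.prod_univ_two]
        field_simp)

open Classical in
/-- The local parametrization of `R` at the point `p`: it sends `τ` near `0` to the point of `R`
near `p` whose local variable is `τ`. These parametrizations are the complex structure of `R`. -/
def localParam {K : ℂ} : Surface K → ℂ → Surface K
  | .fin x υ h => if h0 : υ = 0 then paramBranch x (by rw [← h, h0]; norm_num)
      else paramRegular x υ h h0
  | .inf ε => paramInf ε

theorem localParam_zero {K : ℂ} (p : Surface K) : localParam p 0 = p := by
  cases p with
  | inf ε => simp [localParam, paramInf]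
  | fin x υ h =>
    by_cases h0 : υ = 0
    · subst h0; simp [localParam, paramBranch]
    · have hq : quartic K x ≠ 0 := by rw [← h]; exact pow_ne_zero 2 h0
      simp [localParam, h0, paramRegular, div_self hq]

/-- The function `M` is analytic at `p`, in the local variable at `p`. -/
def AnalyticAtPt {K : ℂ} (M : Surface K → ℂ) (p : Surface K) : Prop :=
  AnalyticAt ℂ (fun τ => M (localParam p τ)) 0

/-- The order of `M` at `p`, in the local variable at `p`:
negative at a pole, positive at a zero. -/
def ordAt {K : ℂ} (M : Surface K → ℂ) (p : Surface K) : WithTop ℤ :=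
  meromorphicOrderAt (fun τ => M (localParam p τ)) 0

/-- The field `K₁`: `M` has finitely many singularities on `R`, each of them a pole of finite order.
The value that `M` takes in `ℂ` at a pole carries no information. -/
structure IsMeromorphic {K : ℂ} (M : Surface K → ℂ) : Prop where
  finite_singular : {p : Surface K | ¬ AnalyticAtPt M p}.Finite
  pole_of_singular : ∀ p, ¬ AnalyticAtPt M p →
    MeromorphicAt (fun τ => M (localParam p τ)) 0 ∧ ordAt M p < 0

/-- `M` is a function `M(b₁, b₂, a₁, a₂; ·)`: it belongs to `K₁`, its poles are exactly `b₁, b₂`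
(simple if `b₁ ≠ b₂`, a double pole if `b₁ = b₂`), and its zeros are exactly `a₁, a₂`
(simple if `a₁ ≠ a₂`, a double zero if `a₁ = a₂`). -/
structure IsElementary {K : ℂ} (b₁ b₂ a₁ a₂ : Surface K) (M : Surface K → ℂ) : Prop where
  mero : IsMeromorphic M
  pole_iff : ∀ p, ordAt M p < 0 ↔ p = b₁ ∨ p = b₂
  simple_poles : b₁ ≠ b₂ → ordAt M b₁ = ((-1 : ℤ) : WithTop ℤ) ∧ ordAt M b₂ = ((-1 : ℤ) : WithTop ℤ)
  double_pole : b₁ = b₂ → ordAt M b₁ = ((-2 : ℤ) : WithTop ℤ)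
  zero_iff : ∀ p, 0 < ordAt M p ↔ p = a₁ ∨ p = a₂
  simple_zeros : a₁ ≠ a₂ → ordAt M a₁ = ((1 : ℤ) : WithTop ℤ) ∧ ordAt M a₂ = ((1 : ℤ) : WithTop ℤ)
  double_zero : a₁ = a₂ → ordAt M a₁ = ((2 : ℤ) : WithTop ℤ)

/-- `dΥ/dx` at a finite point `p` of `R` that is not a branch point
(there the local variable is `x` minus the affix of `p`). -/
def upsilonDot {K : ℂ} (p : Surface K) : ℂ :=
  deriv (fun τ => upsilon (localParam p τ)) 0

/-- `d²Υ/dx²` at a finite point `p` of `R` that is not a branch point. -/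
def upsilonDDot {K : ℂ} (p : Surface K) : ℂ :=
  iteratedDeriv 2 (fun τ => upsilon (localParam p τ)) 0

/-- The function `(x - a) / (x - η)` on `R`, with the limit value `1` at the points at infinity;
for `a = ∞` it is read as `1 / (x - η)`, with the limit value `0` there. -/
def quotFn {K : ℂ} (a : OnePoint ℂ) (η : ℂ) : Surface K → ℂ :=
  match a with
  | OnePoint.infty => fun p => match p with
    | .fin x _ _ => 1 / (x - η)
    | .inf _ => 0
  | OnePoint.some a => fun p => match p with
    | .fin x _ _ => (x - a) / (x - η)
    | .inf _ => 1

end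

end DiscreteWedge

open DiscreteWedge

open Filter Topology Polynomial

/-! Write `f = Υ²`. Suppose the poles of `M` are finite and absorbed by a quadratic `Q(x)`. The sum
of the values of `Q M` on the two sheets, and `Υ` times their difference, depend on `x` alone. They
have removable singularities and polynomial growth, so by Riemann and Liouville they are polynomials
of degree at most 2 and 4. The second one vanishes at the four distinct branch points and is
therefore a constant multiple of `f`. Hence `Q M = q + c Υ` with `deg q ≤ 2`
(`exists_eq_polynomial_add_upsilon`).

Necessity. Take `Q = (x - b₁)(x - b₂)`. A zero of `M` at `(a, α)` gives `q(a) = -c α`. The point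
`(b, -β)` opposite a pole is not a pole, although `Q` vanishes there, so the numerator vanishes:
`q(b) = c β`, with higher contact when the pole is double. In each of the last three criteria `c =
0` would force `q = 0`, so `c ≠ 0`. The four linear conditions on the three coefficients of `q / c`
are compatible exactly when the stated relation holds.

Sufficiency. The relation supplies `q` with `c = 1`. Then `(q + Υ)(q - Υ) = q² - f` is nonzero
because `f` is squarefree, has degree at most 4, and is divisible by the four prescribed linear
factors. So it is a constant multiple of their product, and this fixes the sum of the orders of `q +
Υ` and `q - Υ` at every point. Where `Υ` is finite and nonzero the two factors do not vanish
together. At infinity each has order at least `-2` and the sum is `-4`. At a branch point the sum is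
`0` or `2`, and in the latter case both factors vanish. This determines the divisor
(`order_add_upsilon`).

A double pole at a branch point `η` is different: there `Υ` has order 1 in the local variable, which
forces `c = 0`, so that `M = w + v / (x - η)`. Such a function has one zero on the Riemann sphere,
and the zeros of `M` are the points above it. -/

namespace DiscreteWedge

/-! ### Liouville and Riemann: from growth to polynomials -/

/-- An entire function of polynomial growth is a polynomial. -/
theorem exists_polynomial_of_growth {n : ℕ} : ∀ {h : ℂ → ℂ}, Differentiable ℂ h →
    (∃ C R : ℝ, ∀ z, R ≤ ‖z‖ → ‖h z‖ ≤ C * ‖z‖ ^ n) →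
    ∃ P : ℂ[X], P.natDegree ≤ n ∧ ∀ z, h z = P.eval z := by
  induction n with
  | zero =>
    rintro h hd ⟨C, R, hg⟩
    obtain ⟨C', hC'⟩ := (isCompact_closedBall (0 : ℂ) R).exists_bound_of_continuousOn
      hd.continuous.continuousOn
    have hb : Bornology.IsBounded (Set.range h) := by
      refine isBounded_iff_forall_norm_le.2 ⟨max C C', ?_⟩
      rintro _ ⟨z, rfl⟩
      rcases le_total R ‖z‖ with hz | hz
      · exact (by simpa using hg z hz : ‖h z‖ ≤ C).trans (le_max_left _ _)
      · exact (hC' z (by simpa using hz)).trans (le_max_right _ _)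
    obtain ⟨c, hc⟩ := hd.exists_eq_const_of_bounded hb
    exact ⟨Polynomial.C c, by simp, fun z => by simp [hc]⟩
  | succ n ih =>
    rintro h hd ⟨C, R, hg⟩
    -- `(h(z) - h(0)) / z` is again entire and its growth exponent is smaller by one; the base case
    -- is Liouville's theorem.
    have hd' : Differentiable ℂ (dslope h 0) := by
      rw [← differentiableOn_univ] at hd ⊢
      exact (Complex.differentiableOn_dslope Filter.univ_mem).2 hd
    obtain ⟨P, hP, hP'⟩ := ih hd' ⟨C + ‖h 0‖, max R 1, fun z hz => by
      have hR := (le_max_left _ _).trans hz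
      have h1 := (le_max_right _ _).trans hz
      have hz0 : z ≠ 0 := by rintro rfl; norm_num at h1
      have hz0' : 0 < ‖z‖ := norm_pos_iff.2 hz0
      rw [dslope_of_ne _ hz0, slope_def_field, sub_zero, norm_div, div_le_iff₀ hz0']
      calc ‖h z - h 0‖ ≤ ‖h z‖ + ‖h 0‖ := norm_sub_le _ _
        _ ≤ C * ‖z‖ ^ (n + 1) + ‖h 0‖ * ‖z‖ ^ (n + 1) := by
          gcongr
          · exact hg z hR
          · exact le_mul_of_one_le_right (norm_nonneg _) (one_le_pow₀ h1)
        _ = _ := by ring⟩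
    refine ⟨Polynomial.C (h 0) + X * P, ?_, fun z => ?_⟩
    · refine (natDegree_add_le _ _).trans (max_le (by simp) ?_)
      exact natDegree_mul_le.trans (by rw [natDegree_X]; omega)
    · have := sub_smul_dslope h 0 z
      rw [hP', sub_zero, smul_eq_mul] at this
      simp [this]

/-- A function with only isolated, removable singularities and of polynomial growth
is a polynomial. -/
theorem exists_polynomial_of_removable {h : ℂ → ℂ} {n : ℕ}
    (hd : ∀ x, ∀ᶠ z in 𝓝[≠] x, DifferentiableAt ℂ h z)
    (hb : ∀ x, ∃ C : ℝ, ∀ᶠ z in 𝓝[≠] x, ‖h z‖ ≤ C)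
    (hg : ∃ C R : ℝ, ∀ z, R ≤ ‖z‖ → ‖h z‖ ≤ C * ‖z‖ ^ n) :
    ∃ P : ℂ[X], P.natDegree ≤ n ∧ ∀ x, Tendsto h (𝓝[≠] x) (𝓝 (P.eval x)) := by
  have hlim : ∀ x, Tendsto h (𝓝[≠] x) (𝓝 (limUnder (𝓝[≠] x) h)) := fun x => by
    obtain ⟨C, hC⟩ := hb x
    refine Complex.tendsto_limUnder_of_differentiable_on_punctured_nhds_of_bounded_under (hd x)
      ⟨C + ‖h x‖, eventually_map.2 (hC.mono fun z hz => ?_)⟩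
    exact (norm_sub_le _ _).trans (by gcongr)
  -- `H` fills in the removable singularities. It equals `h` wherever `h` is differentiable, and it
  -- is entire.
  set H : ℂ → ℂ := fun x => limUnder (𝓝[≠] x) h with hH
  have hHh : ∀ z, DifferentiableAt ℂ h z → H z = h z := fun z hz =>
    tendsto_nhds_unique (hlim z) (hz.continuousAt.tendsto.mono_left nhdsWithin_le_nhds)
  have hHd : Differentiable ℂ H := fun x => by
    have hev : ∀ᶠ z in 𝓝[≠] x, H z = h z := (hd x).mono hHh
    have h1 : ∀ᶠ z in 𝓝[≠] x, DifferentiableAt ℂ H z := by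
      filter_upwards [eventually_eventually_nhdsWithin.2 hev, hd x, self_mem_nhdsWithin]
        with z hz hz' hzx
      rw [(isOpen_compl_singleton.nhdsWithin_eq hzx)] at hz
      exact hz'.congr_of_eventuallyEq hz
    refine (Complex.analyticAt_of_differentiable_on_punctured_nhds_of_continuousAt h1 ?_).differentiableAt
    rw [← continuousWithinAt_compl_self]
    exact (hlim x).congr' (hev.mono fun z hz => hz.symm)
  obtain ⟨C, R, hg⟩ := hg
  -- With radius `R + 1` the bound on `h` holds on a whole punctured neighbourhood of `z`, so it
  -- passes to the limit `H z`.
  obtain ⟨P, hP, hP'⟩ := exists_polynomial_of_growth (n := n) hHd ⟨C, R + 1, fun z hz => by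
    have hz' : ∀ᶠ w in 𝓝[≠] z, R ≤ ‖w‖ := by
      refine nhdsWithin_le_nhds ?_
      filter_upwards [continuous_norm.continuousAt.eventually (lt_mem_nhds
        (show R < ‖z‖ by linarith))] with w hw using hw.le
    have hc : Tendsto (fun w : ℂ => C * ‖w‖ ^ n) (𝓝[≠] z) (𝓝 (C * ‖z‖ ^ n)) :=
      ((by fun_prop : Continuous fun w : ℂ => C * ‖w‖ ^ n).tendsto z).mono_left nhdsWithin_le_nhds
    exact le_of_tendsto_of_tendsto (hlim z).norm hc (hz'.mono hg)⟩
  exact ⟨P, hP, fun x => by rw [← hP']; exact hlim x⟩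

/-! ### Analytic branches of the square root -/

theorem analyticAt_sqrt {z : ℂ} (hz : z ∈ Complex.slitPlane) : AnalyticAt ℂ Complex.sqrt z := by
  have : Complex.sqrt = fun a : ℂ => a ^ (2⁻¹ : ℂ) := by ext; rfl
  rw [this]
  exact analyticAt_id.cpow analyticAt_const hz

@[simp] theorem csqrt_zero : Complex.sqrt 0 = 0 := by simp [Complex.sqrt]

@[simp] theorem csqrt_one : Complex.sqrt 1 = 1 := by simp [Complex.sqrt]

theorem csqrt_ne_zero {z : ℂ} (hz : z ≠ 0) : Complex.sqrt z ≠ 0 := fun h => hz (by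
  rw [← sqrt_sq z, h]; norm_num)

/-- At `b = a` the quotient `b / a` equals `1`, which is off the cut even when `a` itself lies on
it. -/
theorem analyticAt_sqrtNear {a : ℂ} (ha : a ≠ 0) : AnalyticAt ℂ (sqrtNear a) a := by
  have : sqrtNear a = fun b => Complex.sqrt a * Complex.sqrt (b / a) := by
    ext b; simp [sqrtNear, ha]
  rw [this]
  refine analyticAt_const.mul (AnalyticAt.fun_comp (analyticAt_sqrt ?_) (by fun_prop))
  simp [ha]

section

variable {K : ℂ}

/-! ### The branch points and the quartic -/

theorem eta_quadratic (K : ℂ) (j : Fin 2) :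
    eta K j 0 ^ 2 + (K ^ 2 - 2) * eta K j 0 + 1 = 0 ∧
    eta K j 1 ^ 2 + (K ^ 2 - 6) * eta K j 1 + 1 = 0 := by
  have h1 := sqrt_sq (4 - (K ^ 2 - 2) ^ 2)
  have h2 := sqrt_sq ((K ^ 2 - 6) ^ 2 - 4)
  fin_cases j <;>
    simp only [eta, Fin.zero_eta, Fin.mk_one, Matrix.cons_val_zero, Matrix.cons_val_one] <;>
    constructor
  · linear_combination (Complex.I ^ 2 / 4) * h1 + ((4 - (K ^ 2 - 2) ^ 2) / 4) * Complex.I_sq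
  · linear_combination (1 / 4) * h2
  · linear_combination (Complex.I ^ 2 / 4) * h1 + ((4 - (K ^ 2 - 2) ^ 2) / 4) * Complex.I_sq
  · linear_combination (1 / 4) * h2

/-- The branch points are distinct. -/
theorem eta_injective (hre : 0 < K.re) (him : 0 < K.im) :
    Function.Injective fun p : Fin 2 × Fin 2 => eta K p.1 p.2 := by
  -- `Im K² = 2 Re K Im K > 0`, while the discriminants vanish only for `K²` in `{0, 4, 8}`.
  have hK2 : ∀ r : ℝ, K ^ 2 ≠ r := fun r h => by
    have := congrArg Complex.im h
    rw [sq, Complex.mul_im, Complex.ofReal_im] at this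
    nlinarith [mul_pos hre him]
  have hs1 : Complex.sqrt (4 - (K ^ 2 - 2) ^ 2) ≠ 0 := csqrt_ne_zero fun h => by
    have : K ^ 2 * (4 - K ^ 2) = 0 := by linear_combination h
    rcases mul_eq_zero.1 this with h | h
    · exact hK2 0 (by simpa using h)
    · exact hK2 4 (by push_cast; linear_combination -h)
  have hs2 : Complex.sqrt ((K ^ 2 - 6) ^ 2 - 4) ≠ 0 := csqrt_ne_zero fun h => by
    have : (K ^ 2 - 8) * (K ^ 2 - 4) = 0 := by linear_combination h
    rcases mul_eq_zero.1 this with h | h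
    · exact hK2 8 (by push_cast; linear_combination h)
    · exact hK2 4 (by push_cast; linear_combination h)
  -- The difference of the two quadratics is `4 x`, so `0` would be the common root, but both have
  -- constant term `1`.
  have h01 : ∀ j j', eta K j 0 ≠ eta K j' 1 := fun j j' h => by
    have h1 := (eta_quadratic K j).1
    have h2 := (eta_quadratic K j').2
    rw [← h] at h2
    have h0 : eta K j 0 = 0 := by linear_combination (h1 - h2) / 4
    rw [h0] at h1
    norm_num at h1
  have h0 : eta K 0 0 ≠ eta K 1 0 := fun h => by
    simp only [eta, Matrix.cons_val_zero, Matrix.cons_val_one] at h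
    have : Complex.I * Complex.sqrt (4 - (K ^ 2 - 2) ^ 2) = 0 := by linear_combination -h
    exact mul_ne_zero Complex.I_ne_zero hs1 this
  have h1 : eta K 0 1 ≠ eta K 1 1 := fun h => by
    simp only [eta, Matrix.cons_val_zero, Matrix.cons_val_one] at h
    exact hs2 (by linear_combination h)
  rintro ⟨j, l⟩ ⟨j', l'⟩ h
  dsimp only at h
  fin_cases j <;> fin_cases l <;> fin_cases j' <;> fin_cases l' <;>
    simp only [Fin.zero_eta, Fin.mk_one, Fin.isValue] at h ⊢ <;>
    first
    | rfl
    | exact absurd h (h01 _ _)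
    | exact absurd h.symm (h01 _ _)
    | exact absurd h h0
    | exact absurd h.symm h0
    | exact absurd h h1
    | exact absurd h.symm h1

/-- The quartic as a polynomial. -/
noncomputable def quarticPoly (K : ℂ) : ℂ[X] := ∏ p : Fin 2 × Fin 2, (X - C (eta K p.1 p.2))

@[simp] theorem eval_quarticPoly (x : ℂ) : (quarticPoly K).eval x = quartic K x := by
  simp [quarticPoly, quartic, Fintype.prod_prod_type]

theorem quarticPoly_monic : (quarticPoly K).Monic :=
  monic_prod_of_monic _ _ fun p _ => monic_X_sub_C (eta K p.1 p.2)

theorem natDegree_quarticPoly : (quarticPoly K).natDegree = 4 := by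
  simp [quarticPoly, natDegree_prod_of_monic _ _ fun (p : Fin 2 × Fin 2) _ => monic_X_sub_C (eta K p.1 p.2)]

theorem quartic_fun : quartic K = fun x => (quarticPoly K).eval x := by
  ext; simp

theorem quartic_eq_zero_iff {x : ℂ} : quartic K x = 0 ↔ ∃ j l, x = eta K j l := by
  simp [quartic, sub_eq_zero]

theorem quarticPoly_separable (hη : Function.Injective fun p : Fin 2 × Fin 2 => eta K p.1 p.2) :
    (quarticPoly K).Separable := separable_prod_X_sub_C_iff.2 hη

theorem analyticAt_quartic (x : ℂ) : AnalyticAt ℂ (quartic K) x := by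
  rw [quartic_fun]; exact (quarticPoly K).differentiable.analyticAt x

theorem deriv_quartic_ne_zero
    (hη : Function.Injective fun p : Fin 2 × Fin 2 => eta K p.1 p.2) {x : ℂ}
    (hx : quartic K x = 0) : deriv (quartic K) x ≠ 0 := by
  rw [quartic_fun, Polynomial.deriv]
  exact (quarticPoly_separable hη).aeval_derivative_ne_zero (by simpa using hx)

theorem analyticAt_dslope_quartic (x : ℂ) : AnalyticAt ℂ (dslope (quartic K) x) x := by
  have hd : DifferentiableOn ℂ (quartic K) Set.univ := by
    rw [quartic_fun]; exact (quarticPoly K).differentiable.differentiableOn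
  exact ((Complex.differentiableOn_dslope Filter.univ_mem).2 hd).analyticAt Filter.univ_mem

/-! ### The functions `x` and `Υ` in local variables -/

/-- The coordinate `x` on the finite part of the surface. -/
def xc : Surface K → ℂ
  | .fin x _ _ => x
  | .inf _ => 0

@[simp] theorem xc_fin (x υ : ℂ) (h : υ ^ 2 = quartic K x) : xc (.fin x υ h) = x := rfl

@[simp] theorem upsilon_fin (x υ : ℂ) (h : υ ^ 2 = quartic K x) : upsilon (.fin x υ h) = υ := rfl

theorem fin_congr {x υ x' υ' : ℂ} {h : υ ^ 2 = quartic K x} (hx : x = x') (hυ : υ = υ') :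
    Surface.fin x υ h = .fin x' υ' (by rw [← hx, ← hυ, h]) := by
  subst hx hυ; rfl

theorem localParam_regular {x υ : ℂ} (h : υ ^ 2 = quartic K x) (h0 : υ ≠ 0) (τ : ℂ) :
    localParam (.fin x υ h) τ = paramRegular x υ h h0 τ := by
  simp [localParam, h0]

theorem localParam_branch {x : ℂ} (h : (0 : ℂ) ^ 2 = quartic K x) (τ : ℂ) :
    localParam (.fin x 0 h) τ = paramBranch x (by rw [← h]; norm_num) τ := by
  simp [localParam]

theorem localParam_inf {ε : ℤˣ} {τ : ℂ} (hτ : τ ≠ 0) :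
    ∃ h, localParam (.inf ε : Surface K) τ = .fin τ⁻¹ (((ε : ℤ) : ℂ) * (τ⁻¹) ^ 2 *
      Complex.sqrt (∏ j : Fin 2, ∏ l : Fin 2, (1 - eta K j l * τ))) h := by
  refine ⟨?_, ?_⟩
  · exact (by
        have hε : (((ε : ℤ) : ℂ)) ^ 2 = 1 := by
          rcases Int.units_eq_one_or ε with rfl | rfl <;> norm_num
        rw [mul_pow, mul_pow, sqrt_sq, hε]
        simp only [quartic, Fin.prod_univ_two]
        field_simp)
  · simp [localParam, paramInf, hτ]

theorem xc_regular {x υ : ℂ} (h : υ ^ 2 = quartic K x) (h0 : υ ≠ 0) :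
    (fun τ => xc (localParam (.fin x υ h) τ)) = fun τ => x + τ := by
  ext τ; rw [localParam_regular h h0]; rfl

theorem upsilon_regular {x υ : ℂ} (h : υ ^ 2 = quartic K x) (h0 : υ ≠ 0) :
    (fun τ => upsilon (localParam (.fin x υ h) τ)) =
      fun τ => υ * Complex.sqrt (quartic K (x + τ) / quartic K x) := by
  ext τ; rw [localParam_regular h h0]; rfl

theorem xc_branch {x : ℂ} (h : (0 : ℂ) ^ 2 = quartic K x) :
    (fun τ => xc (localParam (.fin x 0 h) τ)) = fun τ => x + τ ^ 2 := by
  ext τ; rw [localParam_branch h]; rfl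

theorem upsilon_branch {x : ℂ} (h : (0 : ℂ) ^ 2 = quartic K x) :
    (fun τ => upsilon (localParam (.fin x 0 h) τ)) =
      fun τ => τ * sqrtNear (dslope (quartic K) x x) (dslope (quartic K) x (x + τ ^ 2)) := by
  ext τ; rw [localParam_branch h]; rfl

theorem xc_inf (ε : ℤˣ) :
    (fun τ => xc (localParam (.inf ε : Surface K) τ)) =ᶠ[𝓝[≠] 0] fun τ => τ⁻¹ := by
  filter_upwards [self_mem_nhdsWithin] with τ hτ
  obtain ⟨h, e⟩ := localParam_inf (K := K) (ε := ε) hτ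
  rw [e, xc_fin]

/-- The local form of `Υ` at infinity, up to the factor `x²`. -/
noncomputable def infFactor (K : ℂ) (ε : ℤˣ) (τ : ℂ) : ℂ :=
  ((ε : ℤ) : ℂ) * Complex.sqrt (∏ j : Fin 2, ∏ l : Fin 2, (1 - eta K j l * τ))

theorem analyticAt_infFactor (ε : ℤˣ) : AnalyticAt ℂ (infFactor K ε) 0 := by
  refine analyticAt_const.mul (AnalyticAt.fun_comp (analyticAt_sqrt ?_) ?_)
  · simp
  · simp only [Fin.prod_univ_two]; fun_prop

theorem upsilon_inf (ε : ℤˣ) :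
    (fun τ => upsilon (localParam (.inf ε : Surface K) τ)) =ᶠ[𝓝[≠] 0]
      fun τ => (τ⁻¹) ^ 2 * infFactor K ε τ := by
  filter_upwards [self_mem_nhdsWithin] with τ hτ
  obtain ⟨h, e⟩ := localParam_inf (K := K) (ε := ε) hτ
  rw [e, upsilon_fin, infFactor]; ring

theorem analyticAt_xc {x υ : ℂ} (h : υ ^ 2 = quartic K x) :
    AnalyticAt ℂ (fun τ => xc (localParam (.fin x υ h) τ)) 0 := by
  by_cases h0 : υ = 0
  · subst h0; rw [xc_branch h]; fun_prop
  · rw [xc_regular h h0]; fun_prop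

/-- Distinctness of the branch points matters where `υ = 0`: there `f(x) / (x - η)` takes the value
`f'(η) ≠ 0`, so its square root is analytic in `τ`. -/
theorem analyticAt_upsilon
    (hη : Function.Injective fun p : Fin 2 × Fin 2 => eta K p.1 p.2)
    {x υ : ℂ} (h : υ ^ 2 = quartic K x) :
    AnalyticAt ℂ (fun τ => upsilon (localParam (.fin x υ h) τ)) 0 := by
  by_cases h0 : υ = 0
  · subst h0; rw [upsilon_branch h]
    have hq : quartic K x = 0 := by rw [← h]; norm_num
    refine analyticAt_id.mul (AnalyticAt.fun_comp (g := sqrtNear (dslope (quartic K) x x))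
      (f := fun τ => dslope (quartic K) x (x + τ ^ 2)) ?_ ?_)
    · simp only [ne_eq, OfNat.ofNat_ne_zero, not_false_eq_true, zero_pow, add_zero]
      exact analyticAt_sqrtNear (by rw [dslope_same]; exact deriv_quartic_ne_zero hη hq)
    · refine AnalyticAt.fun_comp (g := dslope (quartic K) x) (f := fun τ => x + τ ^ 2) ?_ (by fun_prop)
      simpa using analyticAt_dslope_quartic x
  · rw [upsilon_regular h h0]
    have hq : quartic K x ≠ 0 := by rw [← h]; exact pow_ne_zero 2 h0
    refine analyticAt_const.mul (AnalyticAt.fun_comp (analyticAt_sqrt ?_) ?_)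
    · simp [hq]
    · refine AnalyticAt.div_const ?_
      exact AnalyticAt.fun_comp (g := quartic K) (analyticAt_quartic _) (by fun_prop)

theorem meromorphicAt_xc (p : Surface K) : MeromorphicAt (fun τ => xc (localParam p τ)) 0 := by
  cases p with
  | fin x υ h => exact (analyticAt_xc h).meromorphicAt
  | inf ε => exact (MeromorphicAt.id 0).inv.congr (xc_inf ε).symm

theorem meromorphicAt_upsilon
    (hη : Function.Injective fun p : Fin 2 × Fin 2 => eta K p.1 p.2) (p : Surface K) :
    MeromorphicAt (fun τ => upsilon (localParam p τ)) 0 := by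
  cases p with
  | fin x υ h => exact (analyticAt_upsilon hη h).meromorphicAt
  | inf ε => exact (((MeromorphicAt.id 0).inv.pow 2).mul
      (analyticAt_infFactor ε).meromorphicAt).congr (upsilon_inf ε).symm

theorem meromorphicAt_polynomial {g : ℂ → ℂ} (hg : MeromorphicAt g 0) (P : ℂ[X]) :
    MeromorphicAt (fun τ => P.eval (g τ)) 0 := by
  induction P using Polynomial.induction_on' with
  | add P Q hP hQ => simpa [Pi.add_def] using hP.add hQ
  | monomial n a => simpa [Pi.mul_def] using (MeromorphicAt.const a 0).mul (hg.pow n)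

theorem analyticAt_polynomial {g : ℂ → ℂ} {z : ℂ} (hg : AnalyticAt ℂ g z) (P : ℂ[X]) :
    AnalyticAt ℂ (fun τ => P.eval (g τ)) z :=
  AnalyticAt.fun_comp (P.differentiable.analyticAt _) hg

/-! ### Orders of `x - a` -/

/-- The order of `x - a` at the points of the surface. -/
theorem order_xc_sub_of_ne {x υ a : ℂ} (h : υ ^ 2 = quartic K x) (hx : x ≠ a) :
    meromorphicOrderAt (fun τ => xc (localParam (.fin x υ h) τ) - a) 0 = 0 := by
  have ha : AnalyticAt ℂ (fun τ => xc (localParam (.fin x υ h) τ) - a) 0 :=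
    (analyticAt_xc h).sub analyticAt_const
  rw [ha.meromorphicOrderAt_eq, ha.analyticOrderAt_eq_zero.2]
  · rfl
  · rw [localParam_zero]; exact sub_ne_zero.2 hx

theorem order_xc_sub_regular {x υ : ℂ} (h : υ ^ 2 = quartic K x) (h0 : υ ≠ 0) :
    meromorphicOrderAt (fun τ => xc (localParam (.fin x υ h) τ) - x) 0 = 1 := by
  have := xc_regular h h0
  simp only [funext_iff] at this
  simp only [this, add_sub_cancel_left]
  exact meromorphicOrderAt_id

theorem order_xc_sub_branch {x : ℂ} (h : (0 : ℂ) ^ 2 = quartic K x) :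
    meromorphicOrderAt (fun τ => xc (localParam (.fin x 0 h) τ) - x) 0 = 2 := by
  have := xc_branch h
  simp only [funext_iff] at this
  simp only [this, add_sub_cancel_left]
  have := meromorphicOrderAt_pow (f := (id : ℂ → ℂ)) (MeromorphicAt.id (0 : ℂ)) (n := 2)
  rw [meromorphicOrderAt_id] at this
  simpa [Pi.pow_def] using this

theorem order_xc_sub_inf (ε : ℤˣ) (a : ℂ) :
    meromorphicOrderAt (fun τ => xc (localParam (.inf ε : Surface K) τ) - a) 0
      = ((-1 : ℤ) : WithTop ℤ) := by
  have e : (fun τ => xc (localParam (.inf ε : Surface K) τ) - a) =ᶠ[𝓝[≠] 0]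
      fun τ => τ⁻¹ * (1 - a * τ) := by
    filter_upwards [xc_inf (K := K) ε, self_mem_nhdsWithin] with τ h hτ
    have : τ ≠ 0 := hτ
    rw [h]; field_simp
  have ha : AnalyticAt ℂ (fun τ : ℂ => 1 - a * τ) 0 := by fun_prop
  rw [meromorphicOrderAt_congr e, fun_meromorphicOrderAt_mul (f := fun τ : ℂ => τ⁻¹) (MeromorphicAt.id 0).inv
    ha.meromorphicAt]
  have h1 : meromorphicOrderAt (fun τ : ℂ => τ⁻¹) 0 = -meromorphicOrderAt (id : ℂ → ℂ) 0 :=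
    meromorphicOrderAt_inv
  rw [meromorphicOrderAt_id] at h1
  rw [h1, ha.meromorphicOrderAt_eq,
    ha.analyticOrderAt_eq_zero.2 (by simp)]
  rfl

theorem order_xc_sub_ne_top (p : Surface K) (a : ℂ) :
    meromorphicOrderAt (fun τ => xc (localParam p τ) - a) 0 ≠ ⊤ := by
  cases p with
  | inf ε => rw [order_xc_sub_inf]; exact WithTop.coe_ne_top
  | fin x υ h =>
    by_cases hx : x = a
    · subst hx
      by_cases h0 : υ = 0
      · subst h0; rw [order_xc_sub_branch]; exact WithTop.coe_ne_top (a := (2 : ℤ))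
      · rw [order_xc_sub_regular h h0]; exact WithTop.coe_ne_top (a := (1 : ℤ))
    · rw [order_xc_sub_of_ne h hx]; exact WithTop.coe_ne_top (a := (0 : ℤ))

/-- No `x - a` vanishes identically near `p`, so a small punctured disc avoids finitely many
affixes. With `E` empty this only says that the points near `p` are finite. -/
theorem eventually_xc_notMem (p : Surface K) {E : Set ℂ} (hE : E.Finite) :
    ∀ᶠ τ in 𝓝[≠] (0 : ℂ), ∃ x υ h, localParam p τ = .fin x υ h ∧ x ∉ E := by
  have h1 : ∀ᶠ τ in 𝓝[≠] (0 : ℂ), ∃ x υ h, localParam p τ = .fin x υ h := by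
    cases p with
    | inf ε =>
      filter_upwards [self_mem_nhdsWithin] with τ hτ
      obtain ⟨h, e⟩ := localParam_inf (K := K) (ε := ε) hτ
      exact ⟨_, _, h, e⟩
    | fin x υ h =>
      refine Eventually.of_forall fun τ => ?_
      by_cases h0 : υ = 0
      · subst h0; exact ⟨_, _, _, localParam_branch h τ⟩
      · exact ⟨_, _, _, localParam_regular h h0 τ⟩
  have h2 : ∀ᶠ τ in 𝓝[≠] (0 : ℂ), ∀ a ∈ E, xc (localParam p τ) - a ≠ 0 := by
    refine (eventually_all_finite hE).2 fun a _ => ?_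
    exact (meromorphicOrderAt_ne_top_iff_eventually_ne_zero
      ((meromorphicAt_xc p).sub (MeromorphicAt.const a 0))).1 (order_xc_sub_ne_top p a)
  filter_upwards [h1, h2] with τ h h'
  obtain ⟨x, υ, hυ, e⟩ := h
  refine ⟨x, υ, hυ, e, fun hx => h' x hx ?_⟩
  rw [e, xc_fin, sub_self]

theorem eventually_upsilon_sq (p : Surface K) :
    ∀ᶠ τ in 𝓝[≠] (0 : ℂ), upsilon (localParam p τ) ^ 2 = quartic K (xc (localParam p τ)) := by
  filter_upwards [eventually_xc_notMem p Set.finite_empty] with τ h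
  obtain ⟨x, υ, hυ, e, -⟩ := h
  rw [e]; exact hυ

/-! ### From coordinate discs to neighbourhoods in the `x`-plane -/

/-- Every point over a punctured neighbourhood of `x₀` lies in the punctured coordinate discs
centred at the points over `x₀`. -/
theorem eventually_of_localParam {G : Surface K → Prop} {x₀ : ℂ}
    (hG : ∀ υ₀ h₀, ∀ᶠ τ in 𝓝[≠] (0 : ℂ), G (localParam (.fin x₀ υ₀ h₀) τ)) :
    ∀ᶠ x in 𝓝[≠] x₀, ∀ υ h, G (.fin x υ h) := by
  by_cases hx : quartic K x₀ = 0
  · have h0 : (0 : ℂ) ^ 2 = quartic K x₀ := by rw [hx]; norm_num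
    -- The two points over `x` have local variables `τ = ±√(x - x₀)`, both tending to `0`; changing
    -- the sign of `τ` exchanges the sheets.
    have hc : Tendsto (fun x => Complex.sqrt (x - x₀)) (𝓝[≠] x₀) (𝓝[≠] 0) := by
      refine tendsto_nhdsWithin_iff.2 ⟨?_, ?_⟩
      · have : ContinuousAt (fun x => Complex.sqrt (x - x₀)) x₀ := by
          refine ContinuousAt.comp' (f := fun x => x - x₀) ?_ (by fun_prop)
          simp only [sub_self]
          exact Complex.continuousAt_sqrt (by simp)
        simpa using this.tendsto.mono_left nhdsWithin_le_nhds
      · filter_upwards [self_mem_nhdsWithin] with x hx using csqrt_ne_zero (sub_ne_zero.2 hx)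
    have hn : Tendsto (fun τ : ℂ => -τ) (𝓝[≠] 0) (𝓝[≠] 0) := by
      refine tendsto_nhdsWithin_iff.2 ⟨?_, ?_⟩
      · simpa using (continuous_neg.tendsto (0 : ℂ)).mono_left nhdsWithin_le_nhds
      · filter_upwards [self_mem_nhdsWithin] with x hx using neg_ne_zero.2 hx
    filter_upwards [hc.eventually (hG 0 h0), (hn.comp hc).eventually (hG 0 h0)] with x h1 h2 υ h
    rw [localParam_branch h0] at h1 h2
    simp only [Function.comp] at h2
    have hs : upsilon (paramBranch x₀ hx (Complex.sqrt (x - x₀))) ^ 2 = υ ^ 2 := by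
      have : ∀ p : Surface K, (∃ a b c, p = .fin a b c) → upsilon p ^ 2 = quartic K (xc p) := by
        rintro _ ⟨a, b, c, rfl⟩; exact c
      rw [h]
      refine (this (paramBranch x₀ hx (Complex.sqrt (x - x₀))) ⟨_, _, _, rfl⟩).trans ?_
      simp [paramBranch, sqrt_sq]
    have e : x = x₀ + Complex.sqrt (x - x₀) ^ 2 := by rw [sqrt_sq]; ring
    rcases sq_eq_sq_iff_eq_or_eq_neg.1 hs with h3 | h3
    · convert h1 using 1
      exact fin_congr e h3.symm
    · convert h2 using 1
      refine fin_congr (by rw [neg_sq]; exact e) ?_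
      simp only [paramBranch, upsilon_fin] at h3
      rw [neg_sq, neg_mul, h3, neg_neg]
  · obtain ⟨υ₀, h₀⟩ : ∃ υ₀, υ₀ ^ 2 = quartic K x₀ := ⟨_, sqrt_sq _⟩
    have h0 : υ₀ ≠ 0 := by rintro rfl; exact hx (by rw [← h₀]; norm_num)
    have hc : Tendsto (fun x => x - x₀) (𝓝[≠] x₀) (𝓝[≠] 0) := by
      refine tendsto_nhdsWithin_iff.2 ⟨?_, ?_⟩
      · simpa using ((continuous_sub_right x₀).tendsto x₀).mono_left nhdsWithin_le_nhds
      · filter_upwards [self_mem_nhdsWithin] with x hx using sub_ne_zero.2 hx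
    filter_upwards [hc.eventually (hG υ₀ h₀),
      hc.eventually (hG (-υ₀) (by rw [neg_sq, h₀]))] with x h1 h2 υ h
    rw [localParam_regular _ h0] at h1
    rw [localParam_regular _ (neg_ne_zero.2 h0)] at h2
    have e : x = x₀ + (x - x₀) := by ring
    have hs : (υ₀ * Complex.sqrt (quartic K (x₀ + (x - x₀)) / quartic K x₀)) ^ 2 = υ ^ 2 := by
      rw [mul_pow, sqrt_sq, h₀, mul_div_cancel₀ _ hx, h, ← e]
    rcases sq_eq_sq_iff_eq_or_eq_neg.1 hs with h3 | h3
    · convert h1 using 1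
      exact fin_congr e h3.symm
    · convert h2 using 1
      refine fin_congr e ?_
      rw [neg_mul, h3, neg_neg]

/-- The analogue of `eventually_of_localParam` at infinity. -/
theorem eventually_of_localParam_inf {G : Surface K → Prop}
    (hG : ∀ ε, ∀ᶠ τ in 𝓝[≠] (0 : ℂ), G (localParam (.inf ε) τ)) :
    ∃ R : ℝ, ∀ x, R ≤ ‖x‖ → ∀ υ h, G (.fin x υ h) := by
  obtain ⟨r, hr, h1⟩ := Metric.eventually_nhds_iff.1 (eventually_nhdsWithin_iff.1
    ((hG 1).and (hG (-1))))
  refine ⟨r⁻¹ + 1, fun x hx υ h => ?_⟩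
  have hx0 : 0 < ‖x‖ := lt_of_lt_of_le (by positivity) hx
  have hx0' : x ≠ 0 := norm_pos_iff.1 hx0
  have hxi : x⁻¹ ≠ 0 := inv_ne_zero hx0'
  obtain ⟨h1, h2⟩ := h1 (y := x⁻¹) (by
    rw [dist_zero_right, norm_inv]
    exact inv_lt_of_inv_lt₀ hr (by linarith)) hxi
  obtain ⟨h3, e3⟩ := localParam_inf (K := K) (ε := 1) hxi
  obtain ⟨h4, e4⟩ := localParam_inf (K := K) (ε := -1) hxi
  rw [e3] at h1
  rw [e4] at h2
  have hs := h
  rw [show quartic K x = quartic K (x⁻¹)⁻¹ by rw [inv_inv], ← h3] at hs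
  rcases sq_eq_sq_iff_eq_or_eq_neg.1 hs with h5 | h5
  · convert h1 using 1
    exact fin_congr (by simp) h5
  · convert h2 using 1
    refine fin_congr (by simp) (h5.trans ?_)
    simp

/-! ### The two sheets and the normal form `(q + c Υ) / Q` -/

theorem polynomial_growth {n : ℕ} {P : ℂ[X]} (hP : P.natDegree ≤ n) :
    ∃ C : ℝ, 0 ≤ C ∧ ∀ x : ℂ, 1 ≤ ‖x‖ → ‖P.eval x‖ ≤ C * ‖x‖ ^ n := by
  refine ⟨∑ i ∈ Finset.range (n + 1), ‖P.coeff i‖, by positivity, fun x hx => ?_⟩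
  rw [eval_eq_sum_range' (Nat.lt_succ_of_le hP), Finset.sum_mul]
  refine (norm_sum_le _ _).trans (Finset.sum_le_sum fun i hi => ?_)
  rw [norm_mul, norm_pow]
  gcongr
  exact Nat.le_of_lt_succ (Finset.mem_range.1 hi)

theorem quarticPoly_dvd (hη : Function.Injective fun p : Fin 2 × Fin 2 => eta K p.1 p.2)
    {P : ℂ[X]} (hP : ∀ j l, P.eval (eta K j l) = 0) : quarticPoly K ∣ P :=
  Finset.prod_dvd_of_coprime (fun _ _ _ _ hpq => pairwise_coprime_X_sub_C hη hpq)
    fun p _ => dvd_iff_isRoot.2 (hP p.1 p.2)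

theorem norm_csqrt_sq (z : ℂ) : ‖Complex.sqrt z‖ ^ 2 = ‖z‖ := by
  rw [← norm_pow, sqrt_sq]

/-- The two points over `x`. -/
noncomputable def sheet₁ (K x : ℂ) : Surface K := .fin x (Complex.sqrt (quartic K x)) (sqrt_sq _)

/-- The other point over `x`. -/
noncomputable def sheet₂ (K x : ℂ) : Surface K :=
  .fin x (-Complex.sqrt (quartic K x)) (by rw [neg_sq]; exact sqrt_sq _)

/-- The sum of the values of `M` over the two sheets. -/
noncomputable def sheetSum (M : Surface K → ℂ) (x : ℂ) : ℂ := M (sheet₁ K x) + M (sheet₂ K x)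

/-- The difference of the values of `M` over the two sheets, made symmetric by the factor `Υ`. -/
noncomputable def sheetDiff (M : Surface K → ℂ) (x : ℂ) : ℂ :=
  Complex.sqrt (quartic K x) * (M (sheet₁ K x) - M (sheet₂ K x))

/-- The cut of `Complex.sqrt` may exchange the labels of the sheets near `x₀`. Both functions are
unchanged by this exchange, so they can be written with the local parametrizations, which are
analytic. -/
theorem differentiableAt_sheet (hη : Function.Injective fun p : Fin 2 × Fin 2 => eta K p.1 p.2)
    {M : Surface K → ℂ} {x₀ : ℂ} (hx : quartic K x₀ ≠ 0)
    (h1 : AnalyticAtPt M (sheet₁ K x₀)) (h2 : AnalyticAtPt M (sheet₂ K x₀)) :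
    DifferentiableAt ℂ (sheetSum M) x₀ ∧ DifferentiableAt ℂ (sheetDiff M) x₀ := by
  have h0 := csqrt_ne_zero hx
  set y : ℂ → ℂ := fun τ => upsilon (localParam (sheet₁ K x₀) τ) with hy
  have hyd : DifferentiableAt ℂ (fun x => y (x - x₀)) x₀ := by
    refine DifferentiableAt.comp (g := y) x₀ ?_ (by fun_prop)
    rw [sub_self]; exact (analyticAt_upsilon hη _).differentiableAt
  have hM1 : DifferentiableAt ℂ (fun x => M (localParam (sheet₁ K x₀) (x - x₀))) x₀ := by
    refine DifferentiableAt.comp (g := fun τ => M (localParam (sheet₁ K x₀) τ)) x₀ ?_ (by fun_prop)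
    rw [sub_self]; exact AnalyticAt.differentiableAt h1
  have hM2 : DifferentiableAt ℂ (fun x => M (localParam (sheet₂ K x₀) (x - x₀))) x₀ := by
    refine DifferentiableAt.comp (g := fun τ => M (localParam (sheet₂ K x₀) τ)) x₀ ?_ (by fun_prop)
    rw [sub_self]; exact AnalyticAt.differentiableAt h2
  have key : ∀ x, (localParam (sheet₁ K x₀) (x - x₀) = sheet₁ K x ∧
      localParam (sheet₂ K x₀) (x - x₀) = sheet₂ K x ∧
        y (x - x₀) = Complex.sqrt (quartic K x)) ∨
      (localParam (sheet₁ K x₀) (x - x₀) = sheet₂ K x ∧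
      localParam (sheet₂ K x₀) (x - x₀) = sheet₁ K x ∧
        y (x - x₀) = -Complex.sqrt (quartic K x)) := fun x => by
    have e1 : localParam (sheet₁ K x₀) (x - x₀) = paramRegular x₀ _ (sqrt_sq _) h0 (x - x₀) :=
      localParam_regular _ h0 _
    have e2 : localParam (sheet₂ K x₀) (x - x₀) =
        paramRegular x₀ _ (by rw [neg_sq]; exact sqrt_sq _) (neg_ne_zero.2 h0) (x - x₀) :=
      localParam_regular _ (neg_ne_zero.2 h0) _
    have e : x₀ + (x - x₀) = x := by ring
    have e3 : y (x - x₀) = Complex.sqrt (quartic K x₀) *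
      Complex.sqrt (quartic K (x₀ + (x - x₀)) / quartic K x₀) := by
      simp only [hy, e1]; rfl
    have hs : (Complex.sqrt (quartic K x₀) *
        Complex.sqrt (quartic K (x₀ + (x - x₀)) / quartic K x₀)) ^ 2
        = Complex.sqrt (quartic K x) ^ 2 := by
      rw [mul_pow, sqrt_sq, sqrt_sq, mul_div_cancel₀ _ hx, sqrt_sq, e]
    rw [e1, e2, e3]
    rcases sq_eq_sq_iff_eq_or_eq_neg.1 hs with h3 | h3
    · exact Or.inl ⟨fin_congr e h3, fin_congr e (by rw [neg_mul, h3]), h3⟩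
    · exact Or.inr ⟨fin_congr e h3, fin_congr e (by rw [neg_mul, h3, neg_neg]), h3⟩
  constructor
  · have : sheetSum M = fun x => M (localParam (sheet₁ K x₀) (x - x₀)) +
        M (localParam (sheet₂ K x₀) (x - x₀)) := by
      ext x
      rcases key x with ⟨e1, e2, -⟩ | ⟨e1, e2, -⟩ <;> rw [e1, e2, sheetSum]
      ring
    rw [this]; exact hM1.add hM2
  · have : sheetDiff M = fun x => y (x - x₀) * (M (localParam (sheet₁ K x₀) (x - x₀)) -
        M (localParam (sheet₂ K x₀) (x - x₀))) := by
      ext x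
      rcases key x with ⟨e1, e2, e3⟩ | ⟨e1, e2, e3⟩ <;> rw [e1, e2, e3, sheetDiff]
      ring
    rw [this]; exact hyd.mul (hM1.sub hM2)

/-- A function bounded in punctured coordinate discs about the points over `x₀` is bounded over a
punctured neighbourhood of `x₀`. -/
theorem exists_bound_of_localParam {g : Surface K → ℂ} {x₀ : ℂ}
    (hg : ∀ υ₀ h₀, ∃ C : ℝ, ∀ᶠ τ in 𝓝[≠] (0 : ℂ), ‖g (localParam (.fin x₀ υ₀ h₀) τ)‖ ≤ C) :
    ∃ C : ℝ, ∀ᶠ x in 𝓝[≠] x₀, ∀ υ h, ‖g (.fin x υ h)‖ ≤ C := by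
  obtain ⟨C₁, h1⟩ := hg (Complex.sqrt (quartic K x₀)) (sqrt_sq _)
  obtain ⟨C₂, h2⟩ := hg (-Complex.sqrt (quartic K x₀)) (by rw [neg_sq]; exact sqrt_sq _)
  refine ⟨max C₁ C₂, eventually_of_localParam (G := fun p => ‖g p‖ ≤ max C₁ C₂) fun υ₀ h₀ => ?_⟩
  have hs := h₀
  rw [← sqrt_sq (quartic K x₀)] at hs
  rcases sq_eq_sq_iff_eq_or_eq_neg.1 hs with rfl | rfl
  · exact h1.mono fun τ h => h.trans (le_max_left _ _)
  · exact h2.mono fun τ h => h.trans (le_max_right _ _)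

theorem exists_bound_of_order_nonneg {g : ℂ → ℂ} (hg : MeromorphicAt g 0)
    (ho : 0 ≤ meromorphicOrderAt g 0) : ∃ C : ℝ, ∀ᶠ τ in 𝓝[≠] (0 : ℂ), ‖g τ‖ ≤ C := by
  obtain ⟨c, hc⟩ := (tendsto_nhds_iff_meromorphicOrderAt_nonneg hg).2 ho
  exact ⟨‖c‖ + 1, (hc.norm.eventually (gt_mem_nhds (lt_add_one _))).mono fun _ h => h.le⟩

/-- A function with poles bounded by the zeros of a quadratic polynomial `Q(x)` and without poles at
infinity is `(q + c Υ) / Q` with a quadratic polynomial `q` and a constant `c`. -/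
theorem exists_eq_polynomial_add_upsilon
    (hη : Function.Injective fun p : Fin 2 × Fin 2 => eta K p.1 p.2)
    {M : Surface K → ℂ} (hfin : {p : Surface K | ¬ AnalyticAtPt M p}.Finite)
    {Q : ℂ[X]} (hQ : Q.natDegree ≤ 2)
    (hmer : ∀ p : Surface K, MeromorphicAt (fun τ => M (localParam p τ)) 0)
    (hord : ∀ x υ h, 0 ≤ meromorphicOrderAt
      (fun τ => Q.eval (xc (localParam (.fin x υ h : Surface K) τ)) *
        M (localParam (.fin x υ h) τ)) 0)
    (hinf : ∀ ε, AnalyticAtPt M (.inf ε)) :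
    ∃ (q : ℂ[X]) (c : ℂ), q.natDegree ≤ 2 ∧ ∀ p : Surface K, ∀ᶠ τ in 𝓝[≠] (0 : ℂ),
      Q.eval (xc (localParam p τ)) * M (localParam p τ) =
        q.eval (xc (localParam p τ)) + c * upsilon (localParam p τ) := by
  have hbd : ∀ x₀, ∃ C : ℝ, ∀ᶠ x in 𝓝[≠] x₀, ∀ υ h, ‖Q.eval x * M (.fin x υ h)‖ ≤ C := fun x₀ =>
    exists_bound_of_localParam (g := fun p => Q.eval (xc p) * M p) fun υ₀ h₀ =>
      exists_bound_of_order_nonneg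
        ((meromorphicAt_polynomial (meromorphicAt_xc _) Q).mul (hmer _)) (hord _ _ _)
  obtain ⟨CM, RM, hM⟩ : ∃ C R : ℝ, ∀ x, R ≤ ‖x‖ → ∀ υ h, ‖M (.fin x υ h)‖ ≤ C := by
    have h1 : ∀ ε, ∃ C : ℝ, ∀ᶠ τ in 𝓝[≠] (0 : ℂ), ‖M (localParam (.inf ε) τ)‖ ≤ C := fun ε =>
      exists_bound_of_order_nonneg (hmer _) (AnalyticAt.meromorphicOrderAt_nonneg (hinf ε))
    choose C hC using h1
    obtain ⟨R, hR⟩ := eventually_of_localParam_inf (G := fun p => ‖M p‖ ≤ max (C 1) (C (-1)))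
      fun ε => (hC ε).mono fun τ h => h.trans (by
        rcases Int.units_eq_one_or ε with rfl | rfl
        · exact le_max_left _ _
        · exact le_max_right _ _)
    exact ⟨_, R, hR⟩
  obtain ⟨CQ, hCQ, hQg⟩ := polynomial_growth hQ
  obtain ⟨Cf, hCf, hfg⟩ := polynomial_growth (natDegree_quarticPoly (K := K)).le
  -- The affixes to avoid: those of the singularities of `M` and the branch points.
  set E : Set ℂ := xc '' {p : Surface K | ¬ AnalyticAtPt M p} ∪
    Set.range (fun p : Fin 2 × Fin 2 => eta K p.1 p.2) with hE
  have hEf : E.Finite := (hfin.image _).union (Set.finite_range _)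
  have hEev : ∀ x, ∀ᶠ z in 𝓝[≠] x, z ∉ E := fun x => by
    have := (hEf.subset (Set.sdiff_subset (t := {x}))).isClosed.isOpen_compl.mem_nhds
      (show x ∈ (E \ {x})ᶜ by simp)
    filter_upwards [nhdsWithin_le_nhds this, self_mem_nhdsWithin] with z hz hzx hzE
    exact hz ⟨hzE, hzx⟩
  have hdE : ∀ x, x ∉ E → DifferentiableAt ℂ (sheetSum M) x ∧ DifferentiableAt ℂ (sheetDiff M) x := by
    intro x hx
    have h1 : quartic K x ≠ 0 := fun h => by
      obtain ⟨j, l, rfl⟩ := quartic_eq_zero_iff.1 h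
      exact hx (Or.inr ⟨(j, l), rfl⟩)
    refine differentiableAt_sheet hη h1 ?_ ?_
    · by_contra h; exact hx (Or.inl ⟨_, h, rfl⟩)
    · by_contra h; exact hx (Or.inl ⟨_, h, rfl⟩)
  have hQd : Differentiable ℂ fun x => Q.eval x := Q.differentiable
  have hSle : ∀ {C : ℝ} {x : ℂ}, (∀ υ h, ‖Q.eval x * M (.fin x υ h)‖ ≤ C) →
      ‖Q.eval x * sheetSum M x‖ ≤ 2 * C := fun {C x} h => by
    rw [sheetSum, mul_add, two_mul]
    exact norm_add_le_of_le (h _ _) (h _ _)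
  have hDle : ∀ {C : ℝ} {x : ℂ}, (∀ υ h, ‖Q.eval x * M (.fin x υ h)‖ ≤ C) →
      ‖Q.eval x * sheetDiff M x‖ ≤ ‖Complex.sqrt (quartic K x)‖ * (2 * C) := fun {C x} h => by
    rw [sheetDiff, mul_left_comm, norm_mul, mul_sub, two_mul]
    gcongr
    exact norm_sub_le_of_le (h _ _) (h _ _)
  have hQM : ∀ x : ℂ, max RM 1 ≤ ‖x‖ → ∀ υ h, ‖Q.eval x * M (.fin x υ h)‖ ≤ CQ * ‖x‖ ^ 2 * CM := by
    intro x hx υ h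
    rw [norm_mul]
    exact mul_le_mul (hQg x ((le_max_right _ _).trans hx)) (hM x ((le_max_left _ _).trans hx) υ h)
      (norm_nonneg _) (by positivity)
  obtain ⟨s, hs2, hs⟩ := exists_polynomial_of_removable (h := fun x => Q.eval x * sheetSum M x)
    (n := 2)
    (fun x => (hEev x).mono fun z hz => (hQd z).mul (hdE z hz).1)
    (fun x => by
      obtain ⟨C, hC⟩ := hbd x
      exact ⟨2 * C, hC.mono fun z hz => hSle hz⟩)
    ⟨2 * (CQ * CM), max RM 1, fun x hx => (hSle (hQM x hx)).trans_eq (by ring)⟩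
  have hcont : ∀ x, ContinuousAt (fun z => ‖quartic K z‖) x := fun x =>
    (analyticAt_quartic x).continuousAt.norm
  -- The exponent is `4` because `Υ` adds growth `x²` to that of `Q`, and `M` is bounded near
  -- infinity.
  obtain ⟨d, hd4, hd⟩ := exists_polynomial_of_removable (h := fun x => Q.eval x * sheetDiff M x)
    (n := 4)
    (fun x => (hEev x).mono fun z hz => (hQd z).mul (hdE z hz).2)
    (fun x => by
      obtain ⟨C, hC⟩ := hbd x
      -- From `t ≤ t² + 1` with `t = |√f(z)|`, and `|f(z)| < |f(x)| + 1` for `z` near `x`.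
      refine ⟨(‖quartic K x‖ + 2) * (2 * |C|), ?_⟩
      filter_upwards [hC, nhdsWithin_le_nhds ((hcont x).eventually (gt_mem_nhds (lt_add_one _)))]
        with z hz hz'
      refine (hDle hz).trans ?_
      have h1 : ‖Complex.sqrt (quartic K z)‖ ≤ ‖quartic K x‖ + 2 := by
        have := norm_csqrt_sq (quartic K z)
        nlinarith [sq_nonneg (‖Complex.sqrt (quartic K z)‖ - 1),
          norm_nonneg (Complex.sqrt (quartic K z))]
      calc _ ≤ ‖Complex.sqrt (quartic K z)‖ * (2 * |C|) := by gcongr; exact le_abs_self C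
        _ ≤ _ := by gcongr)
    ⟨Real.sqrt Cf * (2 * (CQ * CM)), max RM 1, fun x hx => (hDle (hQM x hx)).trans (by
      have hx1 := (le_max_right _ _).trans hx
      have h1 : ‖Complex.sqrt (quartic K x)‖ ≤ Real.sqrt Cf * ‖x‖ ^ 2 := by
        refine abs_le_of_sq_le_sq' ?_ (by positivity) |>.2
        rw [norm_csqrt_sq, mul_pow, Real.sq_sqrt hCf]
        have := hfg x hx1
        rw [eval_quarticPoly] at this
        exact this.trans_eq (by ring)
      have hCM : 0 ≤ CM := (norm_nonneg _).trans
        (hM x ((le_max_left _ _).trans hx) _ (sqrt_sq _))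
      calc _ ≤ Real.sqrt Cf * ‖x‖ ^ 2 * (2 * (CQ * ‖x‖ ^ 2 * CM)) := by gcongr
        _ = _ := by ring)⟩
  -- `Υ` tends to `0` at a branch point while `Q M` stays bounded. Four distinct roots and degree at
  -- most 4 then make `d` a constant multiple of `f`.
  have hd0 : ∀ j l, d.eval (eta K j l) = 0 := fun j l => by
    refine tendsto_nhds_unique (hd _) ?_
    obtain ⟨C, hC⟩ := hbd (eta K j l)
    refine squeeze_zero_norm' (hC.mono fun z hz => hDle hz) ?_
    have h1 : ContinuousAt (fun z => ‖Complex.sqrt (quartic K z)‖) (eta K j l) := by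
      refine ContinuousAt.norm (ContinuousAt.comp' (f := quartic K) ?_ (analyticAt_quartic _).continuousAt)
      rw [quartic_eta]
      exact Complex.continuousAt_sqrt (by simp)
    have h2 := (h1.tendsto.mono_left (nhdsWithin_le_nhds (s := {eta K j l}ᶜ))).mul_const (2 * C)
    simpa [quartic_eta] using h2
  obtain ⟨e, he⟩ := quarticPoly_dvd hη hd0
  obtain ⟨c, rfl⟩ : ∃ c, e = C c := by
    by_cases he0 : e = 0
    · exact ⟨0, by simp [he0]⟩
    refine ⟨e.coeff 0, eq_C_of_natDegree_le_zero ?_⟩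
    have := natDegree_mul (quarticPoly_monic (K := K)).ne_zero he0
    rw [← he, natDegree_quarticPoly] at this
    omega
  -- A value on one sheet is half of the sum plus or minus half of the difference.
  refine ⟨C (1 / 2) * s, c / 2, (natDegree_C_mul_le _ _).trans hs2, fun p => ?_⟩
  filter_upwards [eventually_xc_notMem p hEf] with τ hτ
  obtain ⟨x, υ, h, e, hx⟩ := hτ
  rw [e, xc_fin, upsilon_fin]
  have hS : Q.eval x * sheetSum M x = s.eval x := tendsto_nhds_unique
    (((hQd x).mul (hdE x hx).1).continuousAt.tendsto.mono_left nhdsWithin_le_nhds) (hs x)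
  have hD : Q.eval x * sheetDiff M x = d.eval x := tendsto_nhds_unique
    (((hQd x).mul (hdE x hx).2).continuousAt.tendsto.mono_left nhdsWithin_le_nhds) (hd x)
  have hf : quartic K x ≠ 0 := fun h => by
    obtain ⟨j, l, rfl⟩ := quartic_eq_zero_iff.1 h
    exact hx (Or.inr ⟨(j, l), rfl⟩)
  have hr := csqrt_ne_zero hf
  have hr2 := sqrt_sq (quartic K x)
  rw [he, eval_mul, eval_C, eval_quarticPoly, ← hr2, sheetDiff] at hD
  have hD' : Q.eval x * (M (sheet₁ K x) - M (sheet₂ K x)) = c * Complex.sqrt (quartic K x) :=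
    mul_left_cancel₀ hr (by linear_combination hD)
  rw [sheetSum] at hS
  rw [eval_mul, eval_C, ← hS]
  have hυ := h
  rw [← hr2] at hυ
  rcases sq_eq_sq_iff_eq_or_eq_neg.1 hυ with rfl | rfl
  · change Q.eval x * M (sheet₁ K x) = _
    linear_combination (1 / 2 : ℂ) * hD'
  · change Q.eval x * M (sheet₂ K x) = _
    linear_combination (-1 / 2 : ℂ) * hD'

/-! ### Divisors and the construction of elementary functions -/

/-- The order of `x - a` at a point of the surface. -/
noncomputable def xOrd (a : ℂ) : Surface K → ℤ
  | .fin x υ _ => open Classical in if x = a then (if υ = 0 then 2 else 1) else 0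
  | .inf _ => -1

theorem order_xc_sub (p : Surface K) (a : ℂ) :
    meromorphicOrderAt (fun τ => xc (localParam p τ) - a) 0 = (xOrd a p : WithTop ℤ) := by
  cases p with
  | inf ε => rw [order_xc_sub_inf]; rfl
  | fin x υ h =>
    by_cases hx : x = a
    · subst hx
      by_cases h0 : υ = 0
      · subst h0; rw [order_xc_sub_branch]; simp [xOrd]
      · rw [order_xc_sub_regular h h0]; simp [xOrd, h0]
    · rw [order_xc_sub_of_ne h hx]; simp [xOrd, hx]

theorem meromorphicAt_xc_sub (p : Surface K) (a : ℂ) :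
    MeromorphicAt (fun τ => xc (localParam p τ) - a) 0 :=
  (meromorphicAt_xc p).sub (MeromorphicAt.const a 0)

/-- Removing the removable singularities of a meromorphic function on the surface. -/
theorem exists_analytic_modification {M₀ : Surface K → ℂ}
    (hmer : ∀ p, MeromorphicAt (fun τ => M₀ (localParam p τ)) 0) {E : Set ℂ} (hE : E.Finite)
    (han : ∀ x υ h, x ∉ E → AnalyticAtPt M₀ (.fin x υ h)) :
    ∃ M : Surface K → ℂ, (∀ p, ordAt M p = ordAt M₀ p) ∧
      (∀ p, MeromorphicAt (fun τ => M (localParam p τ)) 0) ∧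
      ∀ p, 0 ≤ ordAt M p → AnalyticAtPt M p := by
  classical
  let M : Surface K → ℂ := fun p => if AnalyticAtPt M₀ p then M₀ p else
    limUnder (𝓝[≠] 0) fun τ => M₀ (localParam p τ)
  -- Values change only over `E` and at infinity, hence nowhere in a small punctured disc.
  have hM : ∀ p, (fun τ => M (localParam p τ)) =ᶠ[𝓝[≠] 0] fun τ => M₀ (localParam p τ) := fun p => by
    filter_upwards [eventually_xc_notMem p hE] with τ h
    obtain ⟨x, υ, hυ, e, hx⟩ := h
    rw [e]
    exact if_pos (han x υ hυ hx)
  have hord : ∀ p, ordAt M p = ordAt M₀ p := fun p => meromorphicOrderAt_congr (hM p)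
  have hmer' : ∀ p, MeromorphicAt (fun τ => M (localParam p τ)) 0 := fun p =>
    (hmer p).congr (hM p).symm
  refine ⟨M, hord, hmer', fun p hp => ?_⟩
  refine (hmer' p).analyticAt ?_
  rw [← continuousWithinAt_compl_self]
  refine Tendsto.congr' (hM p).symm ?_
  simp only [localParam_zero]
  by_cases h : AnalyticAtPt M₀ p
  · have h1 : M p = M₀ p := if_pos h
    have h2 := AnalyticAt.continuousAt h
    rw [← continuousWithinAt_compl_self, ContinuousWithinAt, localParam_zero] at h2
    rwa [h1]
  · have h1 : M p = limUnder (𝓝[≠] 0) fun τ => M₀ (localParam p τ) := if_neg h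
    rw [hord] at hp
    obtain ⟨c, hc⟩ := (tendsto_nhds_iff_meromorphicOrderAt_nonneg (hmer p)).2 hp
    rwa [h1, hc.limUnder_eq]

open Classical in
/-- A function with the right divisor is elementary. -/
theorem isElementary_of_order {B₁ B₂ A₁ A₂ : Surface K} {M : Surface K → ℂ}
    (hmer : ∀ p, MeromorphicAt (fun τ => M (localParam p τ)) 0)
    (han : ∀ p, 0 ≤ ordAt M p → AnalyticAtPt M p)
    (hord : ∀ p, ordAt M p = (((if p = A₁ then 1 else 0) + (if p = A₂ then 1 else 0)
      - (if p = B₁ then 1 else 0) - (if p = B₂ then 1 else 0) : ℤ) : WithTop ℤ))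
    (h11 : A₁ ≠ B₁) (h12 : A₁ ≠ B₂) (h21 : A₂ ≠ B₁) (h22 : A₂ ≠ B₂) :
    IsElementary B₁ B₂ A₁ A₂ M := by
  have hpole : ∀ p, ordAt M p < 0 ↔ p = B₁ ∨ p = B₂ := fun p => by
    rw [hord, show (0 : WithTop ℤ) = ((0 : ℤ) : WithTop ℤ) from rfl, WithTop.coe_lt_coe]
    grind
  refine ⟨⟨?_, fun p hp => ⟨hmer p, ?_⟩⟩, hpole, fun h => ?_, fun h => ?_, fun p => ?_,
    fun h => ?_, fun h => ?_⟩
  · refine (Set.toFinite {B₁, B₂}).subset fun p hp => (hpole p).1 ?_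
    by_contra h; exact hp (han p (not_lt.1 h))
  · by_contra h; exact hp (han p (not_lt.1 h))
  · rw [hord, hord, WithTop.coe_inj, WithTop.coe_inj]; grind
  · rw [hord, WithTop.coe_inj]; grind
  · rw [hord, show (0 : WithTop ℤ) = ((0 : ℤ) : WithTop ℤ) from rfl, WithTop.coe_lt_coe]
    grind
  · rw [hord, hord, WithTop.coe_inj, WithTop.coe_inj]; grind
  · rw [hord, WithTop.coe_inj]; grind

theorem order_eq_zero_iff {g : ℂ → ℂ} (hg : AnalyticAt ℂ g 0) :
    meromorphicOrderAt g 0 = 0 ↔ g 0 ≠ 0 := by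
  rw [hg.meromorphicOrderAt_eq, ← hg.analyticOrderAt_eq_zero]
  cases analyticOrderAt g 0 with
  | top => simp
  | coe n => exact ⟨fun h => by
      have h' : ((n : ℤ) : WithTop ℤ) = 0 := h
      exact_mod_cast h', fun h => by rw [h]; rfl⟩

/-- The factorization of `q² - f`. -/
theorem exists_factorization (hη : Function.Injective fun p : Fin 2 × Fin 2 => eta K p.1 p.2)
    {q : ℂ[X]} (hq : q.natDegree ≤ 2) {a₁ a₂ b₁ b₂ : ℂ}
    (hdvd : (X - C a₁) * (X - C a₂) * ((X - C b₁) * (X - C b₂)) ∣ q ^ 2 - quarticPoly K) :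
    ∃ κ : ℂ, κ ≠ 0 ∧ ∀ x, q.eval x ^ 2 - quartic K x =
      κ * ((x - a₁) * (x - a₂) * ((x - b₁) * (x - b₂))) := by
  -- A squarefree polynomial of degree 4 is not a square.
  have hne : q ^ 2 - quarticPoly K ≠ 0 := fun h => by
    rw [sub_eq_zero] at h
    have hu : IsUnit q := (quarticPoly_separable hη).squarefree q ⟨1, by rw [← h]; ring⟩
    have h1 := natDegree_quarticPoly (K := K)
    rw [← h, natDegree_pow, natDegree_eq_zero_of_isUnit hu] at h1
    omega
  obtain ⟨e, he⟩ := hdvd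
  have hm : ((X - C a₁) * (X - C a₂) * ((X - C b₁) * (X - C b₂))).Monic := by monicity!
  have hmd : ((X - C a₁) * (X - C a₂) * ((X - C b₁) * (X - C b₂))).natDegree = 4 := by
    compute_degree!
  have he0 : e ≠ 0 := by rintro rfl; rw [mul_zero] at he; exact hne he
  have hdeg := hm.natDegree_mul' he0
  rw [← he, hmd] at hdeg
  have hle : (q ^ 2 - quarticPoly K).natDegree ≤ 4 := by
    refine (natDegree_sub_le _ _).trans (max_le ?_ natDegree_quarticPoly.le)
    exact natDegree_pow_le.trans (by omega)
  have hec := eq_C_of_natDegree_le_zero (show e.natDegree ≤ 0 by omega)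
  refine ⟨e.coeff 0, fun h => he0 (by rw [hec, h, C_0]), fun x => ?_⟩
  have := congrArg (eval x) he
  rw [hec] at this
  simp only [eval_sub, eval_pow, eval_quarticPoly, eval_mul, eval_X, eval_C] at this
  rw [this]; ring

theorem meromorphicAt_add_upsilon (hη : Function.Injective fun p : Fin 2 × Fin 2 => eta K p.1 p.2)
    (q : ℂ[X]) (c : ℂ) (p : Surface K) :
    MeromorphicAt (fun τ => q.eval (xc (localParam p τ)) + c * upsilon (localParam p τ)) 0 :=
  (meromorphicAt_polynomial (meromorphicAt_xc p) q).add
    ((MeromorphicAt.const c 0).mul (meromorphicAt_upsilon hη p))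

theorem analyticAt_add_upsilon (hη : Function.Injective fun p : Fin 2 × Fin 2 => eta K p.1 p.2)
    (q : ℂ[X]) (c : ℂ) {x υ : ℂ} (h : υ ^ 2 = quartic K x) :
    AnalyticAt ℂ (fun τ => q.eval (xc (localParam (.fin x υ h) τ)) +
      c * upsilon (localParam (.fin x υ h) τ)) 0 :=
  (analyticAt_polynomial (analyticAt_xc h) q).add (analyticAt_const.mul (analyticAt_upsilon hη h))

/-- Both terms are `x²` times a function analytic in `τ = 1 / x`. Cancellation of the leading terms
could raise the order, so only a lower bound holds in general. -/
theorem order_add_upsilon_inf {q : ℂ[X]} (hq : q.natDegree ≤ 2) (c : ℂ) (ε : ℤˣ) :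
    ((-2 : ℤ) : WithTop ℤ) ≤ meromorphicOrderAt (fun τ => q.eval (xc (localParam (.inf ε : Surface K) τ)) +
      c * upsilon (localParam (.inf ε : Surface K) τ)) 0 := by
  set g : ℂ → ℂ := fun τ => q.coeff 0 * τ ^ 2 + q.coeff 1 * τ + q.coeff 2 + c * infFactor K ε τ
  have hg : AnalyticAt ℂ g 0 := by
    have := analyticAt_infFactor (K := K) ε
    fun_prop
  have e : (fun τ => q.eval (xc (localParam (.inf ε : Surface K) τ)) +
      c * upsilon (localParam (.inf ε : Surface K) τ)) =ᶠ[𝓝[≠] 0] fun τ => (xc (localParam (.inf ε : Surface K) τ) - 0) ^ 2 * g τ := by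
    filter_upwards [xc_inf (K := K) ε, upsilon_inf (K := K) ε, self_mem_nhdsWithin] with τ h1 h2 hτ
    have : τ ≠ 0 := hτ
    rw [h1, h2, eval_eq_sum_range' (Nat.lt_succ_of_le hq)]
    simp only [Finset.sum_range_succ, Finset.sum_range_zero, g]
    field_simp
    ring
  rw [meromorphicOrderAt_congr e, fun_meromorphicOrderAt_mul (f := fun τ =>
    (xc (localParam (.inf ε : Surface K) τ) - 0) ^ 2)
    ((meromorphicAt_xc_sub _ _).pow 2) hg.meromorphicAt,
    fun_meromorphicOrderAt_pow (meromorphicAt_xc_sub _ _), order_xc_sub]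
  have := hg.meromorphicOrderAt_nonneg
  calc ((-2 : ℤ) : WithTop ℤ) = ((-2 : ℤ) : WithTop ℤ) + 0 := by simp
    _ ≤ _ := by
      refine add_le_add (le_of_eq ?_) this
      rfl

theorem meromorphicAt_quadratic (p : Surface K) (a b : ℂ) :
    MeromorphicAt (fun τ => (xc (localParam p τ) - a) * (xc (localParam p τ) - b)) 0 :=
  (meromorphicAt_xc_sub p a).mul (meromorphicAt_xc_sub p b)

theorem order_quadratic (p : Surface K) (a b : ℂ) :
    meromorphicOrderAt (fun τ => (xc (localParam p τ) - a) * (xc (localParam p τ) - b)) 0 =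
      ((xOrd a p + xOrd b p : ℤ) : WithTop ℤ) := by
  rw [fun_meromorphicOrderAt_mul (meromorphicAt_xc_sub _ _) (meromorphicAt_xc_sub _ _),
    order_xc_sub, order_xc_sub, WithTop.coe_add]

theorem order_rational {M N : Surface K → ℂ} {p : Surface K} {b₁ b₂ : ℂ}
    (hM : MeromorphicAt (fun τ => M (localParam p τ)) 0)
    (h : ∀ᶠ τ in 𝓝[≠] (0 : ℂ), (xc (localParam p τ) - b₁) * (xc (localParam p τ) - b₂) *
      M (localParam p τ) = N (localParam p τ)) :
    meromorphicOrderAt (fun τ => N (localParam p τ)) 0 =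
      ((xOrd b₁ p + xOrd b₂ p : ℤ) : WithTop ℤ) + ordAt M p := by
  rw [← meromorphicOrderAt_congr h, fun_meromorphicOrderAt_mul (meromorphicAt_quadratic _ _ _) hM,
    order_quadratic, ordAt]

open Classical in
/-- The order of `(q + Υ) / ((x - b₁) (x - b₂))` in terms of the zeros of `q² - f`. -/
theorem order_add_upsilon (hη : Function.Injective fun p : Fin 2 × Fin 2 => eta K p.1 p.2)
    {q : ℂ[X]} (hq : q.natDegree ≤ 2) {a₁ α₁ a₂ α₂ b₁ β₁ b₂ β₂ κ : ℂ}
    {hA₁ : α₁ ^ 2 = quartic K a₁} {hA₂ : α₂ ^ 2 = quartic K a₂}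
    {hB₁ : β₁ ^ 2 = quartic K b₁} {hB₂ : β₂ ^ 2 = quartic K b₂}
    (hqa₁ : q.eval a₁ = -α₁) (hqa₂ : q.eval a₂ = -α₂) (hqb₁ : q.eval b₁ = β₁)
    (hqb₂ : q.eval b₂ = β₂) (hβ₁ : β₁ ≠ 0) (hβ₂ : β₂ ≠ 0)
    (hA : (Surface.fin a₁ α₁ hA₁ : Surface K) ≠ .fin a₂ α₂ hA₂) (hκ : κ ≠ 0)
    (hfac : ∀ x, q.eval x ^ 2 - quartic K x = κ * ((x - a₁) * (x - a₂) * ((x - b₁) * (x - b₂))))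
    (p : Surface K) :
    meromorphicOrderAt (fun τ => q.eval (xc (localParam p τ)) + 1 * upsilon (localParam p τ)) 0 =
      ((xOrd b₁ p + xOrd b₂ p + ((if p = .fin a₁ α₁ hA₁ then 1 else 0) +
        (if p = .fin a₂ α₂ hA₂ then 1 else 0) - (if p = .fin b₁ β₁ hB₁ then 1 else 0)
        - (if p = .fin b₂ β₂ hB₂ then 1 else 0)) : ℤ) : WithTop ℤ) := by
  have hN := meromorphicAt_add_upsilon hη q
  -- The product of the two functions is `q² - f`, whose order `hfac` gives; in particular both
  -- orders are finite.
  have hsum : meromorphicOrderAt (fun τ => q.eval (xc (localParam p τ)) +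
        1 * upsilon (localParam p τ)) 0 +
      meromorphicOrderAt (fun τ => q.eval (xc (localParam p τ)) +
        -1 * upsilon (localParam p τ)) 0 =
      ((xOrd a₁ p + xOrd a₂ p + (xOrd b₁ p + xOrd b₂ p) : ℤ) : WithTop ℤ) := by
    rw [← fun_meromorphicOrderAt_mul (hN 1 p) (hN (-1) p), WithTop.coe_add, ← order_quadratic,
      ← order_quadratic, ← fun_meromorphicOrderAt_mul (meromorphicAt_quadratic _ _ _)
        (meromorphicAt_quadratic _ _ _)]
    have hk : meromorphicOrderAt (fun _ : ℂ => κ) 0 = 0 :=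
      (order_eq_zero_iff analyticAt_const).2 hκ
    rw [← zero_add (meromorphicOrderAt (fun τ => (xc (localParam p τ) - a₁) * _ * _) 0), ← hk,
      ← fun_meromorphicOrderAt_mul (f := fun _ => κ) (g := fun τ =>
        (xc (localParam p τ) - a₁) * (xc (localParam p τ) - a₂) *
          ((xc (localParam p τ) - b₁) * (xc (localParam p τ) - b₂))) (MeromorphicAt.const κ 0)
        ((meromorphicAt_quadratic _ _ _).mul (meromorphicAt_quadratic _ _ _))]
    refine meromorphicOrderAt_congr ?_
    filter_upwards [eventually_upsilon_sq p] with τ hτ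
    have := hfac (xc (localParam p τ))
    rw [← hτ] at this
    rw [← this]; ring
  obtain ⟨n₁, hn₁⟩ := WithTop.ne_top_iff_exists.1 (show meromorphicOrderAt (fun τ =>
    q.eval (xc (localParam p τ)) + 1 * upsilon (localParam p τ)) 0 ≠ ⊤ from fun h => by
      rw [h, top_add] at hsum; exact WithTop.top_ne_coe hsum)
  obtain ⟨n₂, hn₂⟩ := WithTop.ne_top_iff_exists.1 (show meromorphicOrderAt (fun τ =>
    q.eval (xc (localParam p τ)) + -1 * upsilon (localParam p τ)) 0 ≠ ⊤ from fun h => by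
      rw [h, add_top] at hsum; exact WithTop.top_ne_coe hsum)
  rw [← hn₁, ← hn₂, ← WithTop.coe_add, WithTop.coe_inj] at hsum
  rw [← hn₁, WithTop.coe_inj]
  cases p with
  | inf ε =>
    -- Two orders that are at least `-2` and sum to `-4` both equal `-2`.
    have h1 := order_add_upsilon_inf (K := K) hq 1 ε
    have h2 := order_add_upsilon_inf (K := K) hq (-1) ε
    rw [← hn₁, WithTop.coe_le_coe] at h1
    rw [← hn₂, WithTop.coe_le_coe] at h2
    simp only [xOrd] at hsum ⊢
    simp
    omega
  | fin x υ h =>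
    have g1 := (analyticAt_add_upsilon hη q 1 h).meromorphicOrderAt_nonneg
    have g2 := (analyticAt_add_upsilon hη q (-1) h).meromorphicOrderAt_nonneg
    have z1 := order_eq_zero_iff (analyticAt_add_upsilon hη q 1 h)
    have z2 := order_eq_zero_iff (analyticAt_add_upsilon hη q (-1) h)
    rw [← hn₁] at g1 z1
    rw [← hn₂] at g2 z2
    rw [show (0 : WithTop ℤ) = ((0 : ℤ) : WithTop ℤ) from rfl, WithTop.coe_le_coe] at g1 g2
    rw [show (0 : WithTop ℤ) = ((0 : ℤ) : WithTop ℤ) from rfl, WithTop.coe_inj,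
      localParam_zero, xc_fin, upsilon_fin] at z1 z2
    simp only [ne_eq, Surface.fin.injEq, xOrd] at hA hsum ⊢
    have hpm : ∀ {a α}, α ^ 2 = quartic K a → x = a → υ = α ∨ υ = -α := fun {a α} hα hx =>
      sq_eq_sq_iff_eq_or_eq_neg.1 (by rw [h, hα, hx])
    have pa₁ := hpm hA₁
    have pa₂ := hpm hA₂
    have pb₁ := hpm hB₁
    have pb₂ := hpm hB₂
    clear hpm hfac hn₁ hn₂ hN
    -- At a branch point there is no pole, since `β₁, β₂ ≠ 0`, and at most one of the two zeros. The
    -- sum of the orders is `0`, or `2` with both functions vanishing.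
    by_cases h0 : υ = 0
    · subst h0
      grind
    · simp only [h0, if_false] at hsum ⊢
      -- As `υ ≠ 0`, the values `q + υ` and `q - υ` are not both zero. One order is `0`, and the sum
      -- gives the other.
      by_cases h1 : q.eval x + 1 * υ = 0
      · have hn : n₂ = 0 := by grind
        have ea₁ : (if x = a₁ then 1 else 0 : ℤ) = if x = a₁ ∧ υ = α₁ then 1 else 0 := by grind
        have ea₂ : (if x = a₂ then 1 else 0 : ℤ) = if x = a₂ ∧ υ = α₂ then 1 else 0 := by grind
        have eb₁ : ¬(x = b₁ ∧ υ = β₁) := by grind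
        have eb₂ : ¬(x = b₂ ∧ υ = β₂) := by grind
        rw [← ea₁, ← ea₂, if_neg eb₁, if_neg eb₂]
        linarith
      · have hn : n₁ = 0 := by grind
        have eb₁ : (if x = b₁ then 1 else 0 : ℤ) = if x = b₁ ∧ υ = β₁ then 1 else 0 := by grind
        have eb₂ : (if x = b₂ then 1 else 0 : ℤ) = if x = b₂ ∧ υ = β₂ then 1 else 0 := by grind
        have ea₁ : ¬(x = a₁ ∧ υ = α₁) := by grind
        have ea₂ : ¬(x = a₂ ∧ υ = α₂) := by grind
        rw [← eb₁, ← eb₂, if_neg ea₁, if_neg ea₂]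
        linarith

/-- Existence of elementary functions with finite poles and zeros. -/
theorem exists_isElementary (hη : Function.Injective fun p : Fin 2 × Fin 2 => eta K p.1 p.2)
    {q : ℂ[X]} (hq : q.natDegree ≤ 2) {a₁ α₁ a₂ α₂ b₁ β₁ b₂ β₂ : ℂ}
    {hA₁ : α₁ ^ 2 = quartic K a₁} {hA₂ : α₂ ^ 2 = quartic K a₂}
    {hB₁ : β₁ ^ 2 = quartic K b₁} {hB₂ : β₂ ^ 2 = quartic K b₂}
    (hqa₁ : q.eval a₁ = -α₁) (hqa₂ : q.eval a₂ = -α₂) (hqb₁ : q.eval b₁ = β₁)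
    (hqb₂ : q.eval b₂ = β₂) (hβ₁ : β₁ ≠ 0) (hβ₂ : β₂ ≠ 0)
    (hA : (Surface.fin a₁ α₁ hA₁ : Surface K) ≠ .fin a₂ α₂ hA₂)
    (hdvd : (X - C a₁) * (X - C a₂) * ((X - C b₁) * (X - C b₂)) ∣ q ^ 2 - quarticPoly K) :
    ∃ M, IsElementary (.fin b₁ β₁ hB₁) (.fin b₂ β₂ hB₂) (.fin a₁ α₁ hA₁) (.fin a₂ α₂ hA₂) M := by
  obtain ⟨κ, hκ, hfac⟩ := exists_factorization hη hq hdvd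
  set M₀ : Surface K → ℂ := fun p =>
    (q.eval (xc p) + 1 * upsilon p) / ((xc p - b₁) * (xc p - b₂)) with hM₀
  have hmer : ∀ p, MeromorphicAt (fun τ => M₀ (localParam p τ)) 0 := fun p =>
    (meromorphicAt_add_upsilon hη q 1 p).div (meromorphicAt_quadratic p b₁ b₂)
  obtain ⟨M, hM, hmer', han⟩ := exists_analytic_modification hmer (E := {b₁, b₂})
    (Set.toFinite _) fun x υ h hx => by
      refine (analyticAt_add_upsilon hη q 1 h).div
        (((analyticAt_xc h).sub analyticAt_const).mul ((analyticAt_xc h).sub analyticAt_const)) ?_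
      simp only [Set.mem_insert_iff, Set.mem_singleton_iff, not_or] at hx
      simp only [localParam_zero, xc_fin]
      exact mul_ne_zero (sub_ne_zero.2 hx.1) (sub_ne_zero.2 hx.2)
  refine ⟨M, isElementary_of_order hmer' han (fun p => ?_) ?_ ?_ ?_ ?_⟩
  · have h1 := order_add_upsilon hη hq (hB₁ := hB₁) (hB₂ := hB₂) hqa₁ hqa₂ hqb₁ hqb₂ hβ₁ hβ₂ hA
      hκ hfac p
    have h2 := order_rational (M := M₀) (N := fun p => q.eval (xc p) + 1 * upsilon p)
      (p := p) (b₁ := b₁) (b₂ := b₂) (hmer p) (by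
        filter_upwards [eventually_xc_notMem p (E := {b₁, b₂}) (Set.toFinite _)] with τ h
        obtain ⟨x, υ, hυ, e, hx⟩ := h
        simp only [Set.mem_insert_iff, Set.mem_singleton_iff, not_or] at hx
        have := mul_ne_zero (sub_ne_zero.2 hx.1) (sub_ne_zero.2 hx.2)
        rw [hM₀]
        dsimp only
        rw [e, xc_fin, upsilon_fin]
        rw [mul_div_cancel₀ _ this])
    rw [h1, WithTop.coe_add, WithTop.add_left_inj WithTop.coe_ne_top] at h2
    rw [hM, ← h2]
  -- A zero equal to a pole would give `q = β` and `q = -β` there, hence `β = 0`.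
  all_goals
    rw [ne_eq, Surface.fin.injEq]
    rintro ⟨rfl, rfl⟩
    grind

/-! ### The normal form of a given elementary function -/

theorem IsMeromorphic.meromorphicAt {M : Surface K → ℂ} (hM : IsMeromorphic M) (p : Surface K) :
    MeromorphicAt (fun τ => M (localParam p τ)) 0 := by
  by_cases h : AnalyticAtPt M p
  · exact AnalyticAt.meromorphicAt h
  · exact (hM.pole_of_singular p h).1

theorem IsElementary.analyticAtPt {B₁ B₂ A₁ A₂ : Surface K} {M : Surface K → ℂ}
    (hM : IsElementary B₁ B₂ A₁ A₂ M) {p : Surface K} (h₁ : p ≠ B₁) (h₂ : p ≠ B₂) :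
    AnalyticAtPt M p := by
  by_contra h
  rcases (hM.pole_iff p).1 (hM.mero.pole_of_singular p h).2 with h | h
  · exact h₁ h
  · exact h₂ h

theorem xOrd_nonneg (a : ℂ) {x υ : ℂ} (h : υ ^ 2 = quartic K x) :
    0 ≤ xOrd a (.fin x υ h : Surface K) := by
  simp only [xOrd]; split_ifs <;> norm_num

theorem xOrd_self {x υ : ℂ} (h : υ ^ 2 = quartic K x) :
    1 ≤ xOrd x (.fin x υ h : Surface K) := by
  simp only [xOrd]; split_ifs <;> norm_num

theorem xOrd_regular {x υ : ℂ} (h : υ ^ 2 = quartic K x) (h0 : υ ≠ 0) :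
    xOrd x (.fin x υ h : Surface K) = 1 := by
  simp [xOrd, h0]

/-- Each simple pole is absorbed by the factor `x - b` that vanishes there, and a double pole by the
two factors together. This is the hypothesis on `Q M` in `exists_eq_polynomial_add_upsilon`. -/
theorem IsElementary.order_nonneg {b₁ β₁ b₂ β₂ : ℂ}
    {hB₁ : β₁ ^ 2 = quartic K b₁} {hB₂ : β₂ ^ 2 = quartic K b₂} {A₁ A₂ : Surface K}
    {M : Surface K → ℂ} (hM : IsElementary (.fin b₁ β₁ hB₁) (.fin b₂ β₂ hB₂) A₁ A₂ M)
    {x υ : ℂ} (h : υ ^ 2 = quartic K x) :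
    0 ≤ ((xOrd b₁ (.fin x υ h : Surface K) + xOrd b₂ (.fin x υ h : Surface K) : ℤ) : WithTop ℤ) +
      ordAt M (.fin x υ h) := by
  have n₁ := xOrd_nonneg b₁ h
  have n₂ := xOrd_nonneg b₂ h
  have key : ∀ n : ℤ, ordAt M (.fin x υ h) = n →
      0 ≤ xOrd b₁ (.fin x υ h : Surface K) + xOrd b₂ (.fin x υ h : Surface K) + n →
      0 ≤ ((xOrd b₁ (.fin x υ h : Surface K) + xOrd b₂ (.fin x υ h : Surface K) : ℤ) :
        WithTop ℤ) + ordAt M (.fin x υ h) := fun n hn hle => by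
    rw [hn, ← WithTop.coe_add]; exact_mod_cast hle
  by_cases h12 : (Surface.fin b₁ β₁ hB₁ : Surface K) = .fin b₂ β₂ hB₂
  · by_cases hp : (Surface.fin x υ h : Surface K) = .fin b₁ β₁ hB₁
    · refine key (-2) (by rw [hp]; exact hM.double_pole h12) ?_
      simp only [Surface.fin.injEq] at h12 hp
      obtain ⟨rfl, rfl⟩ := hp
      obtain ⟨rfl, rfl⟩ := h12
      have := xOrd_self h
      omega
    · refine add_nonneg (by exact_mod_cast add_nonneg n₁ n₂) (not_lt.1 fun hlt => ?_)
      rcases (hM.pole_iff _).1 hlt with h' | h'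
      · exact hp h'
      · exact hp (h'.trans h12.symm)
  · by_cases hp : (Surface.fin x υ h : Surface K) = .fin b₁ β₁ hB₁
    · refine key (-1) (by rw [hp]; exact (hM.simple_poles h12).1) ?_
      simp only [Surface.fin.injEq] at hp
      obtain ⟨rfl, rfl⟩ := hp
      have := xOrd_self h
      omega
    by_cases hp' : (Surface.fin x υ h : Surface K) = .fin b₂ β₂ hB₂
    · refine key (-1) (by rw [hp']; exact (hM.simple_poles h12).2) ?_
      simp only [Surface.fin.injEq] at hp'
      obtain ⟨rfl, rfl⟩ := hp'
      have := xOrd_self h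
      omega
    · refine add_nonneg (by exact_mod_cast add_nonneg n₁ n₂) (not_lt.1 fun hlt => ?_)
      rcases (hM.pole_iff _).1 hlt with h' | h'
      · exact hp h'
      · exact hp' h'

/-- Every elementary function with finite poles is `(q + c Υ) / ((x - b₁) (x - b₂))`. -/
theorem IsElementary.exists_polynomial
    (hη : Function.Injective fun p : Fin 2 × Fin 2 => eta K p.1 p.2) {b₁ β₁ b₂ β₂ : ℂ}
    {hB₁ : β₁ ^ 2 = quartic K b₁} {hB₂ : β₂ ^ 2 = quartic K b₂} {A₁ A₂ : Surface K}
    {M : Surface K → ℂ} (hM : IsElementary (.fin b₁ β₁ hB₁) (.fin b₂ β₂ hB₂) A₁ A₂ M) :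
    ∃ (q : ℂ[X]) (c : ℂ), q.natDegree ≤ 2 ∧
      (∀ p : Surface K, ∀ᶠ τ in 𝓝[≠] (0 : ℂ),
        (xc (localParam p τ) - b₁) * (xc (localParam p τ) - b₂) * M (localParam p τ) =
          q.eval (xc (localParam p τ)) + c * upsilon (localParam p τ)) ∧
      ∀ p : Surface K, meromorphicOrderAt
        (fun τ => q.eval (xc (localParam p τ)) + c * upsilon (localParam p τ)) 0 =
          ((xOrd b₁ p + xOrd b₂ p : ℤ) : WithTop ℤ) + ordAt M p := by
  have hmer := hM.mero.meromorphicAt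
  obtain ⟨q, c, hq, h⟩ := exists_eq_polynomial_add_upsilon hη (M := M)
    (Q := (X - C b₁) * (X - C b₂)) hM.mero.finite_singular (by compute_degree!) hmer
    (fun x υ h => by
      have h1 := order_rational (N := fun p => (xc p - b₁) * (xc p - b₂) * M p) (b₁ := b₁)
        (b₂ := b₂) (hmer (.fin x υ h)) (Eventually.of_forall fun τ => rfl)
      have h2 := hM.order_nonneg h
      rw [← h1] at h2
      simpa using h2)
    fun ε => hM.analyticAtPt (by simp) (by simp)
  simp only [eval_mul, eval_sub, eval_X, eval_C] at h
  exact ⟨q, c, hq, h, fun p => order_rational (N := fun p => q.eval (xc p) + c * upsilon p)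
    (hmer p) (h p)⟩

theorem eval_add_eq_zero_of_order
    (hη : Function.Injective fun p : Fin 2 × Fin 2 => eta K p.1 p.2) {q : ℂ[X]} {c x υ : ℂ}
    (h : υ ^ 2 = quartic K x)
    (ho : 0 < meromorphicOrderAt (fun τ => q.eval (xc (localParam (.fin x υ h : Surface K) τ)) +
      c * upsilon (localParam (.fin x υ h) τ)) 0) :
    q.eval x + c * υ = 0 := by
  have h1 := order_eq_zero_iff (analyticAt_add_upsilon hη q c h)
  by_contra hne
  rw [localParam_zero, xc_fin, upsilon_fin] at h1
  exact ho.ne' (h1.2 hne)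

/-! ### Taylor expansion of `Υ` and order of contact with `q` -/

/-- Second order Taylor expansion of `Υ` at a regular point. -/
theorem exists_upsilon_taylor (hη : Function.Injective fun p : Fin 2 × Fin 2 => eta K p.1 p.2)
    {b β : ℂ} (h : β ^ 2 = quartic K b) :
    ∃ r : ℂ → ℂ, AnalyticAt ℂ r 0 ∧ ∀ τ, upsilon (localParam (.fin b β h : Surface K) τ) =
      β + upsilonDot (.fin b β h : Surface K) * τ +
        upsilonDDot (.fin b β h : Surface K) / 2 * τ ^ 2 + τ ^ 3 * r τ := by
  obtain ⟨r, hr, hr'⟩ := (analyticAt_upsilon hη h).exists_eq_sum_add_pow_mul 3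
  refine ⟨r, hr, fun τ => ?_⟩
  have := hr' τ
  simp only [smul_eq_mul] at this
  rw [this]
  simp only [Finset.sum_range_succ, Finset.sum_range_zero, upsilonDot, upsilonDDot,
    iteratedDeriv_zero, iteratedDeriv_one, localParam_zero, upsilon_fin]
  norm_num [Nat.factorial]
  ring

/-- Divisibility of a polynomial by a power of `x - b`, from its behaviour near `b`. -/
theorem X_sub_C_pow_dvd_of_eventually {n : ℕ} {b : ℂ} {k : ℂ → ℂ} (hk : ContinuousAt k 0) :
    ∀ {P : ℂ[X]}, (∀ᶠ τ in 𝓝[≠] (0 : ℂ), P.eval (b + τ) = τ ^ n * k τ) → (X - C b) ^ n ∣ P := by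
  induction n with
  | zero => intro P _; simp
  | succ n ih =>
    intro P h
    have h1 : Tendsto (fun τ : ℂ => P.eval (b + τ)) (𝓝[≠] 0) (𝓝 (P.eval (b + 0))) :=
      ((by fun_prop : Continuous fun τ : ℂ => P.eval (b + τ)).tendsto 0).mono_left nhdsWithin_le_nhds
    have h2 : Tendsto (fun τ : ℂ => τ ^ (n + 1) * k τ) (𝓝[≠] 0) (𝓝 (0 ^ (n + 1) * k 0)) :=
      (((continuous_pow (n + 1)).tendsto 0).mono_left nhdsWithin_le_nhds).mul
        (hk.tendsto.mono_left nhdsWithin_le_nhds)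
    have h3 := tendsto_nhds_unique (h1.congr' h) h2
    rw [add_zero, pow_succ, mul_zero, zero_mul] at h3
    obtain ⟨R, rfl⟩ := dvd_iff_isRoot.2 h3
    rw [pow_succ']
    refine mul_dvd_mul_left _ (ih ?_)
    filter_upwards [h, self_mem_nhdsWithin] with τ hτ hτ0
    have hτ0 : τ ≠ 0 := hτ0
    simp only [eval_mul, eval_sub, eval_X, eval_C, add_sub_cancel_left] at hτ
    exact mul_left_cancel₀ hτ0 (by rw [hτ]; ring)

/-- The polynomial with given value, derivative and half second derivative at `b`. -/
noncomputable def quadAt (b u v w : ℂ) : ℂ[X] := C u + C v * (X - C b) + C w * (X - C b) ^ 2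

@[simp] theorem eval_quadAt (b u v w x : ℂ) :
    (quadAt b u v w).eval x = u + v * (x - b) + w * (x - b) ^ 2 := by simp [quadAt]

theorem natDegree_quadAt_le (b u v w : ℂ) : (quadAt b u v w).natDegree ≤ 2 := by
  unfold quadAt; compute_degree

theorem exists_eq_quadAt {q : ℂ[X]} (hq : q.natDegree ≤ 2) (b : ℂ) :
    ∃ u v w, q = quadAt b u v w := by
  refine ⟨q.eval b, q.coeff 1 + 2 * q.coeff 2 * b, q.coeff 2, Polynomial.funext fun x => ?_⟩
  rw [eval_quadAt, eval_eq_sum_range' (Nat.lt_succ_of_le hq), eval_eq_sum_range' (Nat.lt_succ_of_le hq)]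
  simp only [Finset.sum_range_succ, Finset.sum_range_zero]
  ring

theorem quadAt_eq_zero (b : ℂ) : quadAt b 0 0 0 = 0 := by simp [quadAt]

/-- The zero of `q - c Υ` at a regular point in terms of Taylor coefficients. -/
theorem X_pow_dvd_taylor (hη : Function.Injective fun p : Fin 2 × Fin 2 => eta K p.1 p.2)
    {b β : ℂ} (h : β ^ 2 = quartic K b) (h0 : β ≠ 0) {u v w c : ℂ} {n : ℕ} (hn : n ≤ 3)
    (h' : (-β) ^ 2 = quartic K b)
    (ho : ((n : ℤ) : WithTop ℤ) ≤ meromorphicOrderAt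
      (fun τ => (quadAt b u v w).eval (xc (localParam (.fin b (-β) h' : Surface K) τ)) +
        c * upsilon (localParam (.fin b (-β) h') τ)) 0) :
    X ^ n ∣ quadAt 0 (u - c * β) (v - c * upsilonDot (.fin b β h : Surface K))
      (w - c * (upsilonDDot (.fin b β h : Surface K) / 2)) := by
  obtain ⟨r, hr, hr'⟩ := exists_upsilon_taylor hη h
  have ha := analyticAt_add_upsilon hη (quadAt b u v w) c h'
  rw [ha.meromorphicOrderAt_eq] at ho
  have ho' : (n : ℕ∞) ≤ analyticOrderAt
      (fun τ => (quadAt b u v w).eval (xc (localParam (.fin b (-β) h' : Surface K) τ)) +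
        c * upsilon (localParam (.fin b (-β) h') τ)) 0 := by
    revert ho
    cases analyticOrderAt (fun τ => (quadAt b u v w).eval
      (xc (localParam (.fin b (-β) h' : Surface K) τ)) +
        c * upsilon (localParam (.fin b (-β) h') τ)) 0 with
    | top => simp
    | coe m =>
      intro ho
      have ho : ((n : ℤ) : WithTop ℤ) ≤ ((m : ℤ) : WithTop ℤ) := ho
      exact_mod_cast ho
  obtain ⟨g, hg, hg'⟩ := (natCast_le_analyticOrderAt ha).1 ho'
  -- The cubic remainder splits as `τ³ r = τⁿ (τ³⁻ⁿ r)`; this is where `n ≤ 3` enters.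
  have key := X_sub_C_pow_dvd_of_eventually (n := n) (b := 0)
    (k := fun τ => g τ + c * τ ^ (3 - n) * r τ) (by
      have := hr.continuousAt
      have := hg.continuousAt
      fun_prop)
    (P := quadAt 0 (u - c * β) (v - c * upsilonDot (.fin b β h : Surface K))
      (w - c * (upsilonDDot (.fin b β h : Surface K) / 2))) (by
    filter_upwards [nhdsWithin_le_nhds hg'] with τ hτ
    have e1 := congrFun (xc_regular h' (neg_ne_zero.2 h0)) τ
    have e2 := congrFun (upsilon_regular h' (neg_ne_zero.2 h0)) τ
    have e3 := congrFun (upsilon_regular h h0) τ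
    have e4 := hr' τ
    -- In the parametrizations at `(b, β)` and `(b, -β)` the values of `Υ` are opposite, so a zero
    -- of `q + c Υ` at the second point is a contact of `q` with `c Υ` at the first.
    have e5 : upsilon (localParam (.fin b (-β) h' : Surface K) τ) =
        -upsilon (localParam (.fin b β h : Surface K) τ) := by rw [e2, e3]; ring
    rw [e5, e1, eval_quadAt, e4, sub_zero, smul_eq_mul] at hτ
    have e6 : τ ^ 3 = τ ^ n * τ ^ (3 - n) := by rw [← pow_add]; congr 1; omega
    rw [eval_quadAt]
    linear_combination hτ + c * r τ * e6)
  simpa using key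

/-- `q² - f` is divisible by powers of `x - b` when `q` agrees with `Υ` at a point over `b`. -/
theorem X_sub_C_pow_dvd_sub (hη : Function.Injective fun p : Fin 2 × Fin 2 => eta K p.1 p.2)
    {b β : ℂ} (h : β ^ 2 = quartic K b) (h0 : β ≠ 0) {q : ℂ[X]} {n : ℕ} {k : ℂ → ℂ}
    (hk : ContinuousAt k 0)
    (hq : ∀ τ, q.eval (b + τ) - upsilon (localParam (.fin b β h : Surface K) τ) = τ ^ n * k τ) :
    (X - C b) ^ n ∣ q ^ 2 - quarticPoly K := by
  -- Along the parametrization `q² - f = (q - Υ)(q + Υ)`.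
  refine X_sub_C_pow_dvd_of_eventually (k := fun τ => k τ *
    (q.eval (b + τ) + upsilon (localParam (.fin b β h : Surface K) τ))) ?_ ?_
  · have := (analyticAt_upsilon hη h).continuousAt
    fun_prop
  · filter_upwards [eventually_upsilon_sq (.fin b β h : Surface K)] with τ hτ
    have e1 := congrFun (xc_regular h h0) τ
    rw [e1] at hτ
    rw [eval_sub, eval_pow, eval_quarticPoly, ← hτ, ← mul_assoc, ← hq]
    ring

theorem quadratic_eq_zero {u v w x y z : ℂ} (hxy : x ≠ y) (hxz : x ≠ z) (hyz : y ≠ z)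
    (hx : u + v * x + w * x ^ 2 = 0) (hy : u + v * y + w * y ^ 2 = 0)
    (hz : u + v * z + w * z ^ 2 = 0) : u = 0 ∧ v = 0 ∧ w = 0 := by
  have h1 : v + w * (x + y) = 0 :=
    mul_left_cancel₀ (sub_ne_zero.2 hxy) (by linear_combination hx - hy)
  have h2 : v + w * (x + z) = 0 :=
    mul_left_cancel₀ (sub_ne_zero.2 hxz) (by linear_combination hx - hz)
  have hw : w = 0 := mul_left_cancel₀ (sub_ne_zero.2 hyz) (by linear_combination h1 - h2)
  subst hw
  have hv : v = 0 := by linear_combination h1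
  subst hv
  exact ⟨by linear_combination hx, rfl, rfl⟩

theorem IsElementary.ordAt_zero_ne_top {B₁ B₂ A₁ A₂ : Surface K} {M : Surface K → ℂ}
    (hM : IsElementary B₁ B₂ A₁ A₂ M) : ordAt M A₁ ≠ ⊤ := by
  by_cases h : A₁ = A₂
  · rw [hM.double_zero h]; exact WithTop.coe_ne_top
  · rw [(hM.simple_zeros h).1]; exact WithTop.coe_ne_top

/-- If the numerator were identically zero its order would be `⊤`, whereas `M` has finite order at
its zero `A₁`. -/
theorem upsilon_coeff_ne_zero {B₁ B₂ A₁ A₂ : Surface K} {M : Surface K → ℂ} {b₁ b₂ c : ℂ} {q : ℂ[X]}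
    (hM : IsElementary B₁ B₂ A₁ A₂ M)
    (ho : ∀ p : Surface K, meromorphicOrderAt
        (fun τ => q.eval (xc (localParam p τ)) + c * upsilon (localParam p τ)) 0 =
          ((xOrd b₁ p + xOrd b₂ p : ℤ) : WithTop ℤ) + ordAt M p) (hq : q = 0) : c ≠ 0 := by
  rintro rfl
  have h := ho A₁
  have h0 : meromorphicOrderAt (fun _ : ℂ => (0 : ℂ)) 0 = ⊤ :=
    meromorphicOrderAt_eq_top_iff.2 (Eventually.of_forall fun _ => rfl)
  simp only [hq, eval_zero, zero_mul, add_zero, h0] at h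
  exact WithTop.add_ne_top.2 ⟨WithTop.coe_ne_top, hM.ordAt_zero_ne_top⟩ h.symm

theorem ne_zero_of_sq {b β : ℂ} (h : β ^ 2 = quartic K b) (hb : ∀ j l, b ≠ eta K j l) : β ≠ 0 := by
  rintro rfl
  obtain ⟨j, l, e⟩ := quartic_eq_zero_iff.1 (by rw [← h]; norm_num : quartic K b = 0)
  exact hb j l e

theorem isCoprime_linear {a b : ℂ} (h : a ≠ b) : IsCoprime (X - C a) (X - C b) :=
  isCoprime_X_sub_C_of_isUnit_sub (sub_ne_zero.2 h).isUnit

theorem coe_le_xOrd_add {p : Surface K} {o : WithTop ℤ} {b₁ b₂ : ℂ} {n : ℤ}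
    (h : n ≤ xOrd b₁ p + xOrd b₂ p) {m : ℤ} (ho : (m : WithTop ℤ) ≤ o) :
    ((n + m : ℤ) : WithTop ℤ) ≤ ((xOrd b₁ p + xOrd b₂ p : ℤ) : WithTop ℤ) + o := by
  rw [WithTop.coe_add]
  exact add_le_add (WithTop.coe_le_coe.2 h) ho

theorem one_le_of_pos {o : WithTop ℤ} (h : 0 < o) : ((1 : ℤ) : WithTop ℤ) ≤ o := by
  cases o with
  | top => exact le_top
  | coe n => exact WithTop.coe_le_coe.2 (by have := WithTop.coe_pos.1 h; omega)

theorem pos_of_one_le {o : WithTop ℤ} (h : ((1 : ℤ) : WithTop ℤ) ≤ o) : 0 < o :=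
  lt_of_lt_of_le (WithTop.coe_lt_coe.2 (by norm_num : (0 : ℤ) < 1)) h

/-! ### The three criteria with poles away from the branch points -/

/-- The second divided difference of a quadratic is its leading coefficient. With `-q(a) = c α` and
`q(b) = c β`, each side of the criterion becomes `-w / c`. -/
theorem lagrange_identity {u v w x b₁ b₂ : ℂ} (h1 : x ≠ b₁) (h2 : x ≠ b₂) (h : b₁ ≠ b₂) :
    -(u + v * x + w * x ^ 2) / ((x - b₁) * (x - b₂)) +
      (u + v * b₁ + w * b₁ ^ 2) / ((x - b₁) * (b₁ - b₂)) +
      (u + v * b₂ + w * b₂ ^ 2) / ((x - b₂) * (b₂ - b₁)) = -w := by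
  have h1 := sub_ne_zero.2 h1
  have h2 := sub_ne_zero.2 h2
  have h3 := sub_ne_zero.2 h
  rw [show b₂ - b₁ = -(b₁ - b₂) by ring]
  field_simp
  ring

/-- Two simple poles and two simple zeros with four distinct affixes. -/
theorem exists_isElementary_iff_of_ne
    (hη : Function.Injective fun p : Fin 2 × Fin 2 => eta K p.1 p.2)
    {a₁ α₁ a₂ α₂ b₁ β₁ b₂ β₂ : ℂ}
    (hA₁ : α₁ ^ 2 = quartic K a₁) (hA₂ : α₂ ^ 2 = quartic K a₂)
    (hB₁ : β₁ ^ 2 = quartic K b₁) (hB₂ : β₂ ^ 2 = quartic K b₂)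
    (h12 : a₁ ≠ a₂) (h11 : a₁ ≠ b₁) (h1 : a₁ ≠ b₂) (h21 : a₂ ≠ b₁) (h22 : a₂ ≠ b₂) (hb : b₁ ≠ b₂)
    (hβ₁ : β₁ ≠ 0) (hβ₂ : β₂ ≠ 0) :
    (∃ M, IsElementary (.fin b₁ β₁ hB₁) (.fin b₂ β₂ hB₂) (.fin a₁ α₁ hA₁) (.fin a₂ α₂ hA₂) M) ↔
      α₂ / ((a₂ - b₁) * (a₂ - b₂)) + β₁ / ((a₂ - b₁) * (b₁ - b₂))
            + β₂ / ((a₂ - b₂) * (b₂ - b₁)) =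
          α₁ / ((a₁ - b₁) * (a₁ - b₂)) + β₁ / ((a₁ - b₁) * (b₁ - b₂))
            + β₂ / ((a₁ - b₂) * (b₂ - b₁)) := by
  constructor
  · rintro ⟨M, hM⟩
    obtain ⟨q, c, hq, -, ho⟩ := hM.exists_polynomial hη
    have za : ∀ {a α} (h : α ^ 2 = quartic K a), 0 < ordAt M (.fin a α h) →
        q.eval a + c * α = 0 := fun {a α} h hpos => by
      refine eval_add_eq_zero_of_order hη h (pos_of_one_le ?_)
      rw [ho]
      exact coe_le_xOrd_add (n := 0) (add_nonneg (xOrd_nonneg _ _) (xOrd_nonneg _ _)) (one_le_of_pos hpos)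
    have za₁ := za hA₁ ((hM.zero_iff _).2 (Or.inl rfl))
    have za₂ := za hA₂ ((hM.zero_iff _).2 (Or.inr rfl))
    -- `M` has no pole at `(b₁, -β₁)`, but the denominator vanishes there, so the numerator must
    -- vanish too.
    have zb₁ : q.eval b₁ + c * -β₁ = 0 := by
      have h : (-β₁) ^ 2 = quartic K b₁ := by rw [neg_sq, hB₁]
      refine eval_add_eq_zero_of_order hη h (pos_of_one_le ?_)
      rw [ho]
      refine coe_le_xOrd_add (n := 1) (m := 0) ?_ (not_lt.1 fun hlt => ?_)
      · have := xOrd_self h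
        have := xOrd_nonneg b₂ h
        omega
      · rcases (hM.pole_iff _).1 hlt with h' | h'
        · exact hβ₁ (self_eq_neg.1 (Surface.fin.inj h').2.symm)
        · exact hb (Surface.fin.inj h').1
    have zb₂ : q.eval b₂ + c * -β₂ = 0 := by
      have h : (-β₂) ^ 2 = quartic K b₂ := by rw [neg_sq, hB₂]
      refine eval_add_eq_zero_of_order hη h (pos_of_one_le ?_)
      rw [ho]
      refine coe_le_xOrd_add (n := 1) (m := 0) ?_ (not_lt.1 fun hlt => ?_)
      · have := xOrd_self h
        have := xOrd_nonneg b₁ h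
        omega
      · rcases (hM.pole_iff _).1 hlt with h' | h'
        · exact hb (Surface.fin.inj h').1.symm
        · exact hβ₂ (self_eq_neg.1 (Surface.fin.inj h').2.symm)
    obtain ⟨u, v, w, rfl⟩ := exists_eq_quadAt hq 0
    simp only [eval_quadAt, sub_zero] at za₁ za₂ zb₁ zb₂
    -- Without `Υ` the quadratic `q` would have the three distinct roots `a₁, a₂, b₁`.
    by_cases hc : c = 0
    · subst hc
      obtain ⟨rfl, rfl, rfl⟩ := quadratic_eq_zero (u := u) (v := v) (w := w) h12 h11 h21
        (by linear_combination za₁)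
        (by linear_combination za₂) (by linear_combination zb₁)
      exact absurd rfl (upsilon_coeff_ne_zero hM ho (quadAt_eq_zero 0))
    have l₁ := lagrange_identity (u := u) (v := v) (w := w) h11 h1 hb
    have l₂ := lagrange_identity (u := u) (v := v) (w := w) h21 h22 hb
    rw [show u + v * b₁ + w * b₁ ^ 2 = c * β₁ by linear_combination zb₁,
      show u + v * b₂ + w * b₂ ^ 2 = c * β₂ by linear_combination zb₂] at l₁ l₂
    rw [show -(u + v * a₁ + w * a₁ ^ 2) = c * α₁ by linear_combination -za₁] at l₁
    rw [show -(u + v * a₂ + w * a₂ ^ 2) = c * α₂ by linear_combination -za₂] at l₂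
    simp only [mul_div_assoc] at l₁ l₂
    exact mul_left_cancel₀ hc (by linear_combination l₂ - l₁)
  · intro heq
    have n11 := sub_ne_zero.2 h11
    have n1 := sub_ne_zero.2 h1
    have n21 := sub_ne_zero.2 h21
    have n22 := sub_ne_zero.2 h22
    have nb := sub_ne_zero.2 hb
    have nb' := sub_ne_zero.2 hb.symm
    -- `q` interpolates `β₁, β₂` at `b₁, b₂`. The leading coefficient `w` is chosen so that `q(a₁) =
    -- -α₁`, and the relation then yields `q(a₂) = -α₂`.
    obtain ⟨w, hw⟩ : ∃ w, w = -(α₁ / ((a₁ - b₁) * (a₁ - b₂)) + β₁ / ((a₁ - b₁) * (b₁ - b₂))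
            + β₂ / ((a₁ - b₂) * (b₂ - b₁))) := ⟨_, rfl⟩
    set q : ℂ[X] := C w * ((X - C b₁) * (X - C b₂)) + C (β₁ / (b₁ - b₂)) * (X - C b₂) +
      C (β₂ / (b₂ - b₁)) * (X - C b₁) with hq
    have hqe : ∀ x, q.eval x = w * ((x - b₁) * (x - b₂)) + β₁ / (b₁ - b₂) * (x - b₂) +
      β₂ / (b₂ - b₁) * (x - b₁) := fun x => by simp [hq]
    have hqa₁ : q.eval a₁ = -α₁ := by
      rw [hqe, hw]; field_simp; ring
    have hqa₂ : q.eval a₂ = -α₂ := by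
      rw [hqe, hw, ← heq]; field_simp; ring
    have hqb₁ : q.eval b₁ = β₁ := by rw [hqe]; field_simp; ring
    have hqb₂ : q.eval b₂ = β₂ := by rw [hqe]; field_simp; ring
    have hroot : ∀ {x υ}, υ ^ 2 = quartic K x → (q.eval x = υ ∨ q.eval x = -υ) →
        X - C x ∣ q ^ 2 - quarticPoly K := fun {x υ} h h' => by
      rw [dvd_iff_isRoot, IsRoot, eval_sub, eval_pow, eval_quarticPoly, ← h]
      rcases h' with h' | h' <;> rw [h'] <;> ring
    refine exists_isElementary hη (q := q) (by rw [hq]; compute_degree) hqa₁ hqa₂ hqb₁ hqb₂ hβ₁ hβ₂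
      (fun h => h12 (Surface.fin.inj h).1) ?_
    refine IsCoprime.mul_dvd ?_ (IsCoprime.mul_dvd (isCoprime_linear h12) ?_ ?_)
      (IsCoprime.mul_dvd (isCoprime_linear hb) ?_ ?_)
    · exact IsCoprime.mul_left
        (IsCoprime.mul_right (isCoprime_linear h11) (isCoprime_linear h1))
        (IsCoprime.mul_right (isCoprime_linear h21) (isCoprime_linear h22))
    · exact hroot hA₁ (Or.inr hqa₁)
    · exact hroot hA₂ (Or.inr hqa₂)
    · exact hroot hB₁ (Or.inl hqb₁)
    · exact hroot hB₂ (Or.inl hqb₂)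

theorem taylor_coeff {u v w : ℂ} {n : ℕ} (h : X ^ n ∣ quadAt 0 u v w) :
    (1 ≤ n → u = 0) ∧ (2 ≤ n → v = 0) ∧ (3 ≤ n → w = 0) := by
  rw [X_pow_dvd_iff] at h
  refine ⟨fun hn => ?_, fun hn => ?_, fun hn => ?_⟩
  · simpa [quadAt] using h 0 (by omega)
  · simpa [quadAt, coeff_X, coeff_C] using h 1 (by omega)
  · simpa [quadAt, coeff_X, coeff_C] using h 2 (by omega)

/-- A double pole and two simple zeros with three distinct affixes. -/
theorem exists_isElementary_iff_double
    (hη : Function.Injective fun p : Fin 2 × Fin 2 => eta K p.1 p.2)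
    {a₁ α₁ a₂ α₂ b β : ℂ}
    (hA₁ : α₁ ^ 2 = quartic K a₁) (hA₂ : α₂ ^ 2 = quartic K a₂) (hB : β ^ 2 = quartic K b)
    (h1 : a₁ ≠ b) (h2 : a₂ ≠ b) (h12 : a₁ ≠ a₂) (hβ : β ≠ 0) :
    (∃ M, IsElementary (.fin b β hB) (.fin b β hB) (.fin a₁ α₁ hA₁) (.fin a₂ α₂ hA₂) M) ↔
      α₁ / (a₁ - b) ^ 2 + β / (a₁ - b) ^ 2 + upsilonDot (.fin b β hB) / (a₁ - b) =
          α₂ / (a₂ - b) ^ 2 + β / (a₂ - b) ^ 2 + upsilonDot (.fin b β hB) / (a₂ - b) := by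
  have n1 := sub_ne_zero.2 h1
  have n2 := sub_ne_zero.2 h2
  set δ := upsilonDot (.fin b β hB) with hδ
  constructor
  · rintro ⟨M, hM⟩
    obtain ⟨q, c, hq, -, ho⟩ := hM.exists_polynomial hη
    obtain ⟨u, v, w, rfl⟩ := exists_eq_quadAt hq b
    have za : ∀ {a α} (h : α ^ 2 = quartic K a), 0 < ordAt M (.fin a α h) →
        (quadAt b u v w).eval a + c * α = 0 := fun {a α} h hpos => by
      refine eval_add_eq_zero_of_order hη h (pos_of_one_le ?_)
      rw [ho]
      exact coe_le_xOrd_add (n := 0) (add_nonneg (xOrd_nonneg _ _) (xOrd_nonneg _ _)) (one_le_of_pos hpos)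
    have za₁ := za hA₁ ((hM.zero_iff _).2 (Or.inl rfl))
    have za₂ := za hA₂ ((hM.zero_iff _).2 (Or.inr rfl))
    have h : (-β) ^ 2 = quartic K b := by rw [neg_sq, hB]
    -- `(x - b)²` has order 2 at `(b, -β)`, which is not a pole, so `q` and `c Υ` agree to first
    -- order at `(b, β)`.
    have zb := taylor_coeff (X_pow_dvd_taylor hη hB hβ (u := u) (v := v) (w := w) (c := c) (n := 2)
      (by norm_num) h (by
        rw [ho]
        refine coe_le_xOrd_add (n := 2) (m := 0) ?_ (not_lt.1 fun hlt => ?_)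
        · rw [xOrd_regular h (neg_ne_zero.2 hβ)]; norm_num
        · have h' := (hM.pole_iff _).1 hlt
          rw [or_self] at h'
          exact hβ (self_eq_neg.1 (Surface.fin.inj h').2.symm)))
    have zu := sub_eq_zero.1 (zb.1 (by norm_num))
    have zv := sub_eq_zero.1 (zb.2.1 le_rfl)
    rw [eval_quadAt, zu, zv] at za₁ za₂
    by_cases hc : c = 0
    · have hw : w = 0 := by
        subst hc
        exact mul_right_cancel₀ (pow_ne_zero 2 n1) (by linear_combination za₁)
      refine absurd hc (upsilon_coeff_ne_zero hM ho ?_)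
      rw [zu, zv, hw, hc, zero_mul, zero_mul, quadAt_eq_zero]
    have e1 : c * (α₁ / (a₁ - b) ^ 2 + β / (a₁ - b) ^ 2 + δ / (a₁ - b)) = -w := by
      field_simp; linear_combination za₁
    have e2 : c * (α₂ / (a₂ - b) ^ 2 + β / (a₂ - b) ^ 2 + δ / (a₂ - b)) = -w := by
      field_simp; linear_combination za₂
    exact mul_left_cancel₀ hc (e1.trans e2.symm)
  · intro heq
    -- Value and slope of `q` at `b` are those of `Υ`; the remaining coefficient is fixed by `q(a₁)
    -- = -α₁`.
    obtain ⟨w, hw⟩ : ∃ w, w = -(α₁ / (a₁ - b) ^ 2 + β / (a₁ - b) ^ 2 + δ / (a₁ - b)) := ⟨_, rfl⟩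
    have hqa₁ : (quadAt b β δ w).eval a₁ = -α₁ := by
      rw [eval_quadAt, hw]; field_simp; ring
    have hqa₂ : (quadAt b β δ w).eval a₂ = -α₂ := by
      rw [eval_quadAt, hw, heq]; field_simp; ring
    have hqb : (quadAt b β δ w).eval b = β := by rw [eval_quadAt]; ring
    have hroot : ∀ {x υ}, υ ^ 2 = quartic K x → (quadAt b β δ w).eval x = -υ →
        X - C x ∣ quadAt b β δ w ^ 2 - quarticPoly K := fun {x υ} h h' => by
      rw [dvd_iff_isRoot, IsRoot, eval_sub, eval_pow, eval_quarticPoly, ← h, h']; ring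
    refine exists_isElementary hη (natDegree_quadAt_le b β δ w) hqa₁ hqa₂ hqb hqb hβ hβ
      (fun h => h12 (Surface.fin.inj h).1) ?_
    refine IsCoprime.mul_dvd ?_ (IsCoprime.mul_dvd (isCoprime_linear h12) ?_ ?_) ?_
    · exact IsCoprime.mul_left
        (IsCoprime.mul_right (isCoprime_linear h1) (isCoprime_linear h1))
        (IsCoprime.mul_right (isCoprime_linear h2) (isCoprime_linear h2))
    · exact hroot hA₁ hqa₁
    · exact hroot hA₂ hqa₂
    · rw [← sq]
      obtain ⟨r, hr, hr'⟩ := exists_upsilon_taylor hη hB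
      refine X_sub_C_pow_dvd_sub hη hB hβ
        (k := fun τ => w - upsilonDDot (.fin b β hB) / 2 - τ * r τ) ?_ fun τ => ?_
      · have := hr.continuousAt
        fun_prop
      · rw [hr', eval_quadAt]; ring

/-- A double pole, a zero at the other point with the same affix and a zero at a branch point. -/
theorem exists_isElementary_iff_conj
    (hη : Function.Injective fun p : Fin 2 × Fin 2 => eta K p.1 p.2)
    {a b β : ℂ} (hA : (0 : ℂ) ^ 2 = quartic K a) (hB : β ^ 2 = quartic K b)
    (hB' : (-β) ^ 2 = quartic K b) (h1 : a ≠ b) (hβ : β ≠ 0) :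
    (∃ M, IsElementary (.fin b β hB) (.fin b β hB) (.fin b (-β) hB') (.fin a 0 hA) M) ↔
      β / (a - b) ^ 2 + upsilonDot (.fin b β hB) / (a - b) + upsilonDDot (.fin b β hB) / 2 = 0 := by
  have n1 := sub_ne_zero.2 h1
  set δ := upsilonDot (.fin b β hB) with hδ
  set ε := upsilonDDot (.fin b β hB) with hε
  constructor
  · rintro ⟨M, hM⟩
    obtain ⟨q, c, hq, -, ho⟩ := hM.exists_polynomial hη
    obtain ⟨u, v, w, rfl⟩ := exists_eq_quadAt hq b
    have za : (quadAt b u v w).eval a + c * 0 = 0 := by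
      refine eval_add_eq_zero_of_order hη hA (pos_of_one_le ?_)
      rw [ho]
      exact coe_le_xOrd_add (n := 0) (add_nonneg (xOrd_nonneg _ _) (xOrd_nonneg _ _))
        (one_le_of_pos ((hM.zero_iff _).2 (Or.inr rfl)))
    -- The order 2 of `(x - b)²` and the zero of `M` at `(b, -β)` add up to 3. So `q` is `c` times
    -- the second Taylor polynomial of `Υ`, and the criterion says that this polynomial vanishes at
    -- the branch point.
    have zb := taylor_coeff (X_pow_dvd_taylor hη hB hβ (u := u) (v := v) (w := w) (c := c) (n := 3)
      le_rfl hB' (by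
        rw [ho]
        refine coe_le_xOrd_add (n := 2) (m := 1) ?_ (one_le_of_pos ((hM.zero_iff _).2 (Or.inl rfl)))
        rw [xOrd_regular hB' (neg_ne_zero.2 hβ)]; norm_num))
    have zu := sub_eq_zero.1 (zb.1 (by norm_num))
    have zv := sub_eq_zero.1 (zb.2.1 (by norm_num))
    have zw := sub_eq_zero.1 (zb.2.2 le_rfl)
    by_cases hc : c = 0
    · refine absurd hc (upsilon_coeff_ne_zero hM ho ?_)
      rw [zu, zv, zw, hc, zero_mul, zero_mul, zero_mul, quadAt_eq_zero]
    rw [eval_quadAt, zu, zv, zw] at za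
    have h2 : c * (2 * β + 2 * δ * (a - b) + ε * (a - b) ^ 2) = 0 := by linear_combination 2 * za
    have h3 := (mul_eq_zero.1 h2).resolve_left hc
    field_simp
    linear_combination h3
  · intro heq
    have hqa : (quadAt b β δ (ε / 2)).eval a = -0 := by
      rw [eval_quadAt]
      field_simp at heq
      linear_combination heq / 2
    have hqb : (quadAt b β δ (ε / 2)).eval b = β := by rw [eval_quadAt]; ring
    refine exists_isElementary hη (natDegree_quadAt_le b β δ (ε / 2)) (by rw [hqb, neg_neg]) hqa
      hqb hqb hβ hβ (fun h => h1 (Surface.fin.inj h).1.symm) ?_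
    rw [show (X - C b) * (X - C a) * ((X - C b) * (X - C b)) = (X - C a) * (X - C b) ^ 3 by ring]
    refine IsCoprime.mul_dvd (isCoprime_linear h1).pow_right ?_ ?_
    · rw [dvd_iff_isRoot, IsRoot, eval_sub, eval_pow, eval_quarticPoly, ← hA, hqa]; ring
    · obtain ⟨r, hr, hr'⟩ := exists_upsilon_taylor hη hB
      refine X_sub_C_pow_dvd_sub hη hB hβ (k := fun τ => -r τ) hr.continuousAt.neg fun τ => ?_
      rw [hr', eval_quadAt]; ring

/-! ### Double pole at a branch point -/

/-- The function `w + v / (x - η)` on the surface. -/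
noncomputable def moebius (η v w : ℂ) : Surface K → ℂ
  | .fin x _ _ => w + v / (x - η)
  | .inf _ => w

theorem analyticAt_comp_inf {F : Surface K → ℂ} {g : ℂ → ℂ} {ε : ℤˣ} (hg : AnalyticAt ℂ g 0)
    (h0 : F (.inf ε) = g 0) (h : ∀ τ ≠ 0, ∀ υ hυ, F (.fin τ⁻¹ υ hυ) = g τ) :
    AnalyticAtPt F (.inf ε) := by
  have : (fun τ => F (localParam (.inf ε) τ)) = g := by
    ext τ
    by_cases hτ : τ = 0
    · rw [hτ, localParam_zero, h0]
    · obtain ⟨hυ, e⟩ := localParam_inf (K := K) (ε := ε) hτ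
      rw [e, h τ hτ]
  rw [AnalyticAtPt, this]
  exact hg

theorem fin_eq_branchPt {η υ : ℂ} (hη : quartic K η = 0) (h : υ ^ 2 = quartic K η) : υ = 0 :=
  pow_eq_zero_iff two_ne_zero |>.1 (by rw [h, hη])

theorem analyticAtPt_moebius {η : ℂ} (hη : quartic K η = 0) (v w : ℂ) {p : Surface K}
    (hp : p ≠ .fin η 0 (by rw [hη]; norm_num)) : AnalyticAtPt (moebius η v w) p := by
  cases p with
  | inf ε =>
    refine analyticAt_comp_inf (g := fun τ => w + v * τ / (1 - η * τ)) ?_ (by simp [moebius])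
      fun τ hτ υ hυ => ?_
    · have : (1 : ℂ) - η * 0 ≠ 0 := by simp
      fun_prop (disch := assumption)
    · change w + v / (τ⁻¹ - η) = _
      rw [← mul_div_mul_right v (τ⁻¹ - η) hτ, sub_mul, inv_mul_cancel₀ hτ]
  | fin x υ h =>
    have hx : x ≠ η := by
      rintro rfl
      exact hp (fin_congr rfl (fin_eq_branchPt hη h))
    have e : (fun τ => moebius η v w (localParam (.fin x υ h : Surface K) τ)) =
        fun τ => w + v / (xc (localParam (.fin x υ h : Surface K) τ) - η) := by
      ext τ
      by_cases h0 : υ = 0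
      · subst h0; rw [localParam_branch]; rfl
      · rw [localParam_regular h h0]; rfl
    rw [AnalyticAtPt, e]
    refine analyticAt_const.add (analyticAt_const.div ((analyticAt_xc h).sub analyticAt_const) ?_)
    rw [localParam_zero, xc_fin]
    exact sub_ne_zero.2 hx

theorem eq_of_eventuallyEq {M N : Surface K → ℂ} {p : Surface K} (hM : AnalyticAtPt M p)
    (hN : AnalyticAtPt N p)
    (h : ∀ᶠ τ in 𝓝[≠] (0 : ℂ), M (localParam p τ) = N (localParam p τ)) : M p = N p := by
  have h1 := (AnalyticAt.continuousAt hM).tendsto.mono_left (nhdsWithin_le_nhds (s := {0}ᶜ))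
  have h2 := (AnalyticAt.continuousAt hN).tendsto.mono_left (nhdsWithin_le_nhds (s := {0}ᶜ))
  rw [localParam_zero] at h1 h2
  exact tendsto_nhds_unique (h1.congr' h) h2

/-- A function whose only pole is a double pole at a branch point is a Moebius function of `x`. -/
theorem IsElementary.eq_moebius (hinj : Function.Injective fun p : Fin 2 × Fin 2 => eta K p.1 p.2)
    {η : ℂ} {h : (0 : ℂ) ^ 2 = quartic K η} {A₁ A₂ : Surface K} {M : Surface K → ℂ}
    (hM : IsElementary (.fin η 0 h) (.fin η 0 h) A₁ A₂ M) :
    ∃ v w : ℂ, (v ≠ 0 ∨ w ≠ 0) ∧ ∀ p, p ≠ .fin η 0 h → M p = moebius η v w p := by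
  have hq0 : quartic K η = 0 := by rw [← h]; norm_num
  obtain ⟨q, c, hq, hev, ho⟩ := hM.exists_polynomial hinj
  obtain ⟨u, v, w, rfl⟩ := exists_eq_quadAt hq η
  -- `(x - η)²` has order 4 in `τ = √(x - η)`, so a double pole of `M` leaves a numerator of order
  -- 2.
  have hB := ho (.fin η 0 h)
  have hx : xOrd η (.fin η 0 h : Surface K) = 2 := by simp [xOrd]
  have ha := analyticAt_add_upsilon hinj (quadAt η u v w) c h
  rw [hM.double_pole rfl, hx, ← WithTop.coe_add, ha.meromorphicOrderAt_eq] at hB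
  have ho' : ((2 : ℕ) : ℕ∞) ≤ analyticOrderAt
      (fun τ => (quadAt η u v w).eval (xc (localParam (.fin η 0 h : Surface K) τ)) +
        c * upsilon (localParam (.fin η 0 h) τ)) 0 := by
    revert hB
    cases analyticOrderAt (fun τ => (quadAt η u v w).eval
      (xc (localParam (.fin η 0 h : Surface K) τ)) +
        c * upsilon (localParam (.fin η 0 h) τ)) 0 with
    | top => simp
    | coe m =>
      intro hB
      have hB : ((m : ℤ) : WithTop ℤ) = ((2 + 2 + -2 : ℤ) : WithTop ℤ) := hB
      rw [WithTop.coe_inj] at hB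
      exact_mod_cast (show (2 : ℕ) ≤ m by omega)
  obtain ⟨g, hg, hg'⟩ := (natCast_le_analyticOrderAt ha).1 ho'
  have hu : u = 0 := by
    have := hg'.self_of_nhds
    rw [localParam_zero, xc_fin, upsilon_fin, eval_quadAt] at this
    linear_combination this
  -- With `u = 0` the numerator is `c τ s(τ) + v τ² + w τ⁴`, where `s(0)² = f'(η) ≠ 0`; order 2
  -- excludes the linear term.
  have hc : c = 0 := by
    set s : ℂ → ℂ := fun τ => sqrtNear (dslope (quartic K) η η) (dslope (quartic K) η (η + τ ^ 2))
    have hd : dslope (quartic K) η η ≠ 0 := by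
      rw [dslope_same]; exact deriv_quartic_ne_zero hinj hq0
    have hs0 : s 0 ≠ 0 := fun h0 => hd (by
      have := sqrtNear_sq (dslope (quartic K) η η) (dslope (quartic K) η (η + 0 ^ 2))
      rw [show sqrtNear _ _ = s 0 from rfl, h0] at this
      simpa using this.symm)
    have hsc : ContinuousAt s 0 := by
      refine ContinuousAt.comp' (g := sqrtNear (dslope (quartic K) η η))
        (f := fun τ => dslope (quartic K) η (η + τ ^ 2)) ?_ ?_
      · simpa using (analyticAt_sqrtNear hd).continuousAt
      · refine ContinuousAt.comp' (g := dslope (quartic K) η) (f := fun τ => η + τ ^ 2) ?_ (by fun_prop)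
        simpa using (analyticAt_dslope_quartic (K := K) η).continuousAt
    have hgc := hg.continuousAt
    have l1 : Tendsto (fun τ => c * s τ) (𝓝[≠] 0) (𝓝 (c * s 0)) :=
      (hsc.tendsto.const_mul c).mono_left nhdsWithin_le_nhds
    have l2 : Tendsto (fun τ => τ * (g τ - v - w * τ ^ 2)) (𝓝[≠] 0)
        (𝓝 (0 * (g 0 - v - w * 0 ^ 2))) :=
      ((by fun_prop : ContinuousAt (fun τ => τ * (g τ - v - w * τ ^ 2)) 0).tendsto).mono_left
        nhdsWithin_le_nhds
    have l3 := tendsto_nhds_unique (l2.congr' (by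
      filter_upwards [nhdsWithin_le_nhds hg', self_mem_nhdsWithin] with τ hτ hτ0
      have hτ0 : τ ≠ 0 := hτ0
      rw [congrFun (xc_branch h) τ, congrFun (upsilon_branch h) τ, eval_quadAt, hu, sub_zero,
        smul_eq_mul] at hτ
      refine mul_left_cancel₀ hτ0 ?_
      simp only [s]
      linear_combination -hτ)) l1
    rw [zero_mul] at l3
    exact (mul_eq_zero.1 l3.symm).resolve_right hs0
  subst hu hc
  refine ⟨v, w, ?_, fun p hp => ?_⟩
  · by_contra hvw
    push Not at hvw
    refine upsilon_coeff_ne_zero hM ho ?_ rfl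
    rw [hvw.1, hvw.2, quadAt_eq_zero]
  · refine eq_of_eventuallyEq (hM.analyticAtPt hp hp) (analyticAtPt_moebius hq0 v w hp) ?_
    filter_upwards [hev p, eventually_xc_notMem p (E := {η}) (Set.toFinite _)] with τ hτ hτ'
    obtain ⟨x, υ, hυ, e, hx⟩ := hτ'
    rw [e] at hτ ⊢
    rw [xc_fin, eval_quadAt] at hτ
    have hx' := sub_ne_zero.2 hx
    change _ = w + v / (x - η)
    refine mul_left_cancel₀ (pow_ne_zero 2 hx') ?_
    rw [show (x - η) ^ 2 * (w + v / (x - η)) = w * (x - η) ^ 2 + v * (x - η) by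
      rw [mul_add, sq, mul_assoc _ _ (v / _), mul_div_cancel₀ _ hx']; ring]
    linear_combination hτ

theorem IsElementary.zero_apply {B₁ B₂ A₁ A₂ : Surface K} {M : Surface K → ℂ}
    (hM : IsElementary B₁ B₂ A₁ A₂ M) {p : Surface K} (hp : p = A₁ ∨ p = A₂) :
    M p = 0 ∧ p ≠ B₁ ∧ p ≠ B₂ := by
  have h := (hM.zero_iff p).2 hp
  have h1 : p ≠ B₁ := fun e => lt_asymm h ((hM.pole_iff p).2 (Or.inl e))
  have h2 : p ≠ B₂ := fun e => lt_asymm h ((hM.pole_iff p).2 (Or.inr e))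
  refine ⟨?_, h1, h2⟩
  have ha := hM.analyticAtPt h1 h2
  by_contra hne
  have := (order_eq_zero_iff ha).2 (by rwa [localParam_zero])
  exact h.ne' this

theorem moebius_quotFn {η a v w : ℂ} (h : w + v / (a - η) = 0) (ha : a ≠ η) {p : Surface K}
    (hp : ∀ υ h, p ≠ .fin η υ h) : moebius η v w p = w * quotFn (a : OnePoint ℂ) η p := by
  cases p with
  | inf ε => exact (mul_one w).symm
  | fin x υ hυ =>
    have hx : x ≠ η := by rintro rfl; exact hp _ _ rfl
    have hx := sub_ne_zero.2 hx
    have ha := sub_ne_zero.2 ha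
    change w + v / (x - η) = w * ((x - a) / (x - η))
    have hv : v = -w * (a - η) := by
      field_simp at h; linear_combination h
    rw [hv]; field_simp; ring

theorem moebius_quotFn_infty {η v : ℂ} (p : Surface K) :
    moebius η v 0 p = v * quotFn OnePoint.infty η p := by
  cases p with
  | inf ε => exact (mul_zero v).symm
  | fin x υ hυ =>
    change 0 + v / (x - η) = v * (1 / (x - η))
    ring

theorem quotFn_eq_moebius {η a : ℂ} (ha : a ≠ η) {p : Surface K} (hp : ∀ υ h, p ≠ .fin η υ h) :
    quotFn (a : OnePoint ℂ) η p = moebius η (η - a) 1 p := by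
  have := sub_ne_zero.2 ha
  rw [moebius_quotFn (a := a) (by field_simp; ring) ha hp, one_mul]

theorem quotFn_infty_eq_moebius {η : ℂ} : (quotFn OnePoint.infty η : Surface K → ℂ) = moebius η 1 0 := by
  ext p; rw [moebius_quotFn_infty, one_mul]

theorem meromorphicAt_quotFn (a : OnePoint ℂ) (η : ℂ) (p : Surface K) :
    MeromorphicAt (fun τ => quotFn a η (localParam p τ)) 0 ∧ ordAt (quotFn a η) p =
      match a with
      | OnePoint.infty => ((-xOrd η p : ℤ) : WithTop ℤ)
      | OnePoint.some a => ((xOrd a p - xOrd η p : ℤ) : WithTop ℤ) := by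
  cases a with
  | infty =>
    have e : (fun τ => quotFn OnePoint.infty η (localParam p τ)) =ᶠ[𝓝[≠] 0]
        (fun τ => xc (localParam p τ) - η)⁻¹ := by
      filter_upwards [eventually_xc_notMem p Set.finite_empty] with τ h
      obtain ⟨x, υ, hυ, e, -⟩ := h
      rw [Pi.inv_apply, e]
      exact one_div _
    refine ⟨(meromorphicAt_xc_sub p η).inv.congr e.symm, ?_⟩
    rw [ordAt, meromorphicOrderAt_congr e, meromorphicOrderAt_inv, order_xc_sub]
    rfl
  | coe a =>
    have e : (fun τ => quotFn (a : OnePoint ℂ) η (localParam p τ)) =ᶠ[𝓝[≠] 0]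
        (fun τ => xc (localParam p τ) - a) / (fun τ => xc (localParam p τ) - η) := by
      filter_upwards [eventually_xc_notMem p Set.finite_empty] with τ h
      obtain ⟨x, υ, hυ, e, -⟩ := h
      rw [Pi.div_apply, e]
      rfl
    refine ⟨((meromorphicAt_xc_sub p a).div (meromorphicAt_xc_sub p η)).congr e.symm, ?_⟩
    rw [ordAt, meromorphicOrderAt_congr e, meromorphicOrderAt_div (meromorphicAt_xc_sub p a)
      (meromorphicAt_xc_sub p η), order_xc_sub, order_xc_sub]
    rfl

theorem ne_fin_of_ne {η : ℂ} (h : (0 : ℂ) ^ 2 = quartic K η) {p : Surface K}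
    (hp : p ≠ .fin η 0 h) : ∀ υ hυ, p ≠ .fin η υ hυ := fun υ hυ e =>
  hp (e.trans (fin_congr rfl (fin_eq_branchPt (by rw [← h]; norm_num) hυ)))

theorem xOrd_branch {η : ℂ} (h : (0 : ℂ) ^ 2 = quartic K η) {x υ : ℂ} (hυ : υ ^ 2 = quartic K x)
    [Decidable ((Surface.fin x υ hυ : Surface K) = .fin η 0 h)] :
    xOrd η (.fin x υ hυ : Surface K) =
      if (Surface.fin x υ hυ : Surface K) = .fin η 0 h then 2 else 0 := by
  by_cases hx : x = η
  · subst hx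
    have h0 := fin_eq_branchPt (by rw [← h]; norm_num) hυ
    subst h0
    simp [xOrd]
  · simp [xOrd, hx]

/-- `(x - a) / (x - η)` is elementary. -/
theorem isElementary_quotFn {η : ℂ} (h : (0 : ℂ) ^ 2 = quartic K η) {A₁ A₂ : Surface K}
    (hA : A₁ = A₂ → ∃ a ha, a ≠ η ∧ A₁ = .fin a 0 ha) (haff : affix A₁ = affix A₂) :
    IsElementary (.fin η 0 h) (.fin η 0 h) A₁ A₂ (quotFn (affix A₁) η) := by
  classical
  have hq0 : quartic K η = 0 := by rw [← h]; norm_num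
  have key : ∀ {A₁ A₂ : Surface K}, A₁ ≠ .fin η 0 h → A₂ ≠ .fin η 0 h →
      (∀ p, p ≠ .fin η 0 h → AnalyticAtPt (quotFn (affix A₁) η) p) →
      (∀ p, ordAt (quotFn (affix A₁) η) p =
        (((if p = A₁ then 1 else 0) + (if p = A₂ then 1 else 0)
          - (if p = .fin η 0 h then 1 else 0) - (if p = .fin η 0 h then 1 else 0) : ℤ) :
            WithTop ℤ)) →
      IsElementary (.fin η 0 h) (.fin η 0 h) A₁ A₂ (quotFn (affix A₁) η) :=
    fun h1 h2 han hord => isElementary_of_order (fun p => (meromorphicAt_quotFn _ _ p).1)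
      (fun p hp => han p fun e => by
        rw [hord, e, if_neg h1.symm, if_neg h2.symm, if_pos rfl] at hp
        exact absurd (WithTop.coe_le_coe.1 hp) (by norm_num)) hord h1 h1 h2 h2
  cases A₁ with
  | inf ε₁ =>
    cases A₂ with
    | fin a₂ α₂ h₂ => exact absurd haff.symm (OnePoint.coe_ne_infty _)
    | inf ε₂ =>
      -- A double zero is allowed only at a branch point, so the zeros at infinity are the two
      -- distinct points.
      have hε : ε₁ ≠ ε₂ := by
        rintro rfl
        obtain ⟨a, ha, -, e⟩ := hA rfl
        exact absurd e (by simp)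
      refine key (by simp) (by simp) (fun p hp => ?_) fun p => ?_
      · change AnalyticAtPt (quotFn OnePoint.infty η) p
        rw [quotFn_infty_eq_moebius]
        exact analyticAtPt_moebius hq0 1 0 hp
      · refine (meromorphicAt_quotFn OnePoint.infty η p).2.trans ?_
        refine WithTop.coe_inj.2 ?_
        cases p with
        | inf ε =>
          simp only [xOrd, Surface.inf.injEq, reduceCtorEq, if_false]
          rcases Int.units_eq_one_or ε with rfl | rfl <;>
            rcases Int.units_eq_one_or ε₁ with rfl | rfl <;>
            rcases Int.units_eq_one_or ε₂ with rfl | rfl <;> first | exact absurd rfl hε | decide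
        | fin x υ hυ =>
          rw [xOrd_branch h hυ]
          simp only [reduceCtorEq, if_false]
          split_ifs <;> norm_num
  | fin a₁ α₁ h₁ =>
    cases A₂ with
    | inf ε₂ => exact absurd haff (OnePoint.coe_ne_infty _)
    | fin a₂ α₂ h₂ =>
      obtain rfl : a₁ = a₂ := OnePoint.coe_injective haff
      have hα : α₁ = α₂ ∨ α₁ = -α₂ := sq_eq_sq_iff_eq_or_eq_neg.1 (by rw [h₁, h₂])
      have hα' : α₁ = α₂ → α₁ = 0 ∧ a₁ ≠ η := fun e => by
        obtain ⟨a, ha, hne, e'⟩ := hA (fin_congr rfl e)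
        obtain ⟨rfl, rfl⟩ := Surface.fin.inj e'
        exact ⟨rfl, hne⟩
      have ha : a₁ ≠ η := by
        rintro rfl
        have e1 := fin_eq_branchPt hq0 h₁
        have e2 := fin_eq_branchPt hq0 h₂
        exact (hα' (e1.trans e2.symm)).2 rfl
      refine key (fun e => ha (Surface.fin.inj e).1) (fun e => ha (Surface.fin.inj e).1)
        (fun p hp => ?_) fun p => ?_
      -- At the point over `η` division by zero gives the two expressions different values, so they
      -- are compared only near `p`.
      · have e : (fun τ => quotFn (a₁ : OnePoint ℂ) η (localParam p τ)) =ᶠ[𝓝 0]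
            fun τ => moebius η (η - a₁) 1 (localParam p τ) := by
          have hev := eventually_nhdsWithin_iff.1
            (eventually_xc_notMem p (E := {η}) (Set.toFinite _))
          refine hev.mono fun τ hτ => quotFn_eq_moebius ha ?_
          by_cases h0 : τ = 0
          · rw [h0, localParam_zero]; exact ne_fin_of_ne h hp
          · obtain ⟨x, υ, hυ, e, hx⟩ := hτ h0
            rw [e]
            exact fun υ' h' e' => hx (Surface.fin.inj e').1
        exact (analyticAtPt_moebius hq0 (η - a₁) 1 hp).congr e.symm
      · refine (meromorphicAt_quotFn (a₁ : OnePoint ℂ) η p).2.trans ?_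
        refine WithTop.coe_inj.2 ?_
        cases p with
        | inf ε => simp [xOrd]
        | fin x υ hυ =>
          rw [xOrd_branch h hυ]
          have hυ' : x = a₁ → υ = α₁ ∨ υ = -α₁ := fun e => by
            subst e; exact sq_eq_sq_iff_eq_or_eq_neg.1 (by rw [hυ, h₁])
          simp only [xOrd, Surface.fin.injEq]
          by_cases hx : x = a₁
          · have : x ≠ η := by rwa [hx]
            simp only [hx, ha, true_and, false_and, if_true, if_false]
            grind
          · simp only [hx, false_and, if_false]
            split_ifs <;> norm_num

/-- A double pole at a branch point. -/
theorem elementary_branch (hinj : Function.Injective fun p : Fin 2 × Fin 2 => eta K p.1 p.2)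
    {η : ℂ} (h : (0 : ℂ) ^ 2 = quartic K η) {A₁ A₂ : Surface K}
    (hA : A₁ = A₂ → ∃ a ha, a ≠ η ∧ A₁ = .fin a 0 ha) :
    ((∃ M, IsElementary (.fin η 0 h) (.fin η 0 h) A₁ A₂ M) ↔ affix A₁ = affix A₂) ∧
      (affix A₁ = affix A₂ →
        IsElementary (.fin η 0 h) (.fin η 0 h) A₁ A₂ (quotFn (affix A₁) η) ∧
        ∀ M, IsElementary (.fin η 0 h) (.fin η 0 h) A₁ A₂ M →
          ∃ c : ℂ, c ≠ 0 ∧ ∀ p, p ≠ .fin η 0 h → M p = c * quotFn (affix A₁) η p) := by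
  refine ⟨⟨?_, fun haff => ⟨_, isElementary_quotFn h hA haff⟩⟩, fun haff =>
    ⟨isElementary_quotFn h hA haff, fun M hM => ?_⟩⟩
  · rintro ⟨M, hM⟩
    obtain ⟨v, w, hvw, hMe⟩ := hM.eq_moebius hinj
    have z₁ := hM.zero_apply (Or.inl rfl)
    have z₂ := hM.zero_apply (Or.inr rfl)
    rw [hMe _ z₁.2.1] at z₁
    rw [hMe _ z₂.2.1] at z₂
    -- Finite zeros lie over roots of `v + w (x - η)`, which has at most one root; a zero at
    -- infinity means `w = 0`, and then there is none.
    have hfin : ∀ {a α hα}, (.fin a α hα : Surface K) ≠ .fin η 0 h →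
        moebius η v w (.fin a α hα : Surface K) = 0 → v + w * (a - η) = 0 := fun {a α hα} hne e => by
      have ha : a - η ≠ 0 := sub_ne_zero.2 fun e => by
        subst e; exact ne_fin_of_ne h hne _ _ rfl
      change w + v / (a - η) = 0 at e
      field_simp at e
      linear_combination e
    cases A₁ with
    | inf ε₁ =>
      cases A₂ with
      | inf ε₂ => rfl
      | fin a₂ α₂ h₂ =>
        have hw : w = 0 := z₁.1
        have := hfin z₂.2.1 z₂.1
        rw [hw, zero_mul, add_zero] at this
        exact absurd hvw (by simp [hw, this])
    | fin a₁ α₁ h₁ =>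
      have e₁ := hfin z₁.2.1 z₁.1
      cases A₂ with
      | inf ε₂ =>
        have hw : w = 0 := z₂.1
        rw [hw, zero_mul, add_zero] at e₁
        exact absurd hvw (by simp [hw, e₁])
      | fin a₂ α₂ h₂ =>
        have e₂ := hfin z₂.2.1 z₂.1
        have hw : w ≠ 0 := by
          rintro rfl
          rw [zero_mul, add_zero] at e₁
          exact absurd hvw (by simp [e₁])
        have : a₁ = a₂ := mul_left_cancel₀ hw (by linear_combination e₁ - e₂)
        rw [affix, affix, this]
  · obtain ⟨v, w, hvw, hMe⟩ := hM.eq_moebius hinj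
    have z₁ := hM.zero_apply (Or.inl rfl)
    rw [hMe _ z₁.2.1] at z₁
    cases A₁ with
    | inf ε₁ =>
      have hw : w = 0 := z₁.1
      subst hw
      exact ⟨v, by simpa using hvw, fun p hp => (hMe p hp).trans (moebius_quotFn_infty p)⟩
    | fin a₁ α₁ h₁ =>
      have ha : a₁ ≠ η := fun e => by
        subst e; exact ne_fin_of_ne h z₁.2.1 _ _ rfl
      have e₁ : w + v / (a₁ - η) = 0 := z₁.1
      refine ⟨w, ?_, fun p hp => (hMe p hp).trans (moebius_quotFn e₁ ha (ne_fin_of_ne h hp))⟩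
      rintro rfl
      rw [zero_add, div_eq_zero_iff, or_iff_left (sub_ne_zero.2 ha)] at e₁
      exact absurd hvw (by simp [e₁])

theorem exists_fin_of_affix {p : Surface K} {x : ℂ} (h : affix p = (x : OnePoint ℂ)) :
    ∃ υ hυ, p = .fin x υ hυ := by
  cases p with
  | inf ε => exact absurd h (OnePoint.infty_ne_coe _)
  | fin x' υ hυ =>
    obtain rfl : x' = x := OnePoint.coe_injective h
    exact ⟨υ, hυ, rfl⟩

end

end DiscreteWedge

/-! ### Assembly of the four statements -/

theorem mainTheorem6 (K : ℂ) (hKre : 0 < K.re) (hKim : 0 < K.im) :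
    -- double pole at a branch point
    (∀ (j l : Fin 2) (A₁ A₂ : Surface K),
      (A₁ = A₂ → ∃ j' l' : Fin 2, (j', l') ≠ (j, l) ∧ A₁ = branchPt K j' l') →
      ((∃ M : Surface K → ℂ,
          IsElementary (branchPt K j l) (branchPt K j l) A₁ A₂ M) ↔ affix A₁ = affix A₂) ∧
      (affix A₁ = affix A₂ →
        IsElementary (branchPt K j l) (branchPt K j l) A₁ A₂ (quotFn (affix A₁) (eta K j l)) ∧
        ∀ M : Surface K → ℂ, IsElementary (branchPt K j l) (branchPt K j l) A₁ A₂ M →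
          ∃ c : ℂ, c ≠ 0 ∧ ∀ p : Surface K, p ≠ branchPt K j l →
            M p = c * quotFn (affix A₁) (eta K j l) p)) ∧
    -- double pole at `B₁`, zeros at the other point `B₂` with the same affix and at a branch point
    (∀ (j l : Fin 2) (B₁ B₂ : Surface K) (b : ℂ),
      affix B₁ = (b : OnePoint ℂ) → affix B₂ = (b : OnePoint ℂ) → B₁ ≠ B₂ →
      (∀ j' l' : Fin 2, b ≠ eta K j' l') →
      ((∃ M : Surface K → ℂ, IsElementary B₁ B₁ B₂ (branchPt K j l) M) ↔
        upsilon B₁ / (eta K j l - b) ^ 2 + upsilonDot B₁ / (eta K j l - b)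
          + upsilonDDot B₁ / 2 = 0)) ∧
    -- two poles and two zeros with four distinct affixes
    (∀ (A₁ A₂ B₁ B₂ : Surface K) (a₁ a₂ b₁ b₂ : ℂ),
      affix A₁ = (a₁ : OnePoint ℂ) → affix A₂ = (a₂ : OnePoint ℂ) →
      affix B₁ = (b₁ : OnePoint ℂ) → affix B₂ = (b₂ : OnePoint ℂ) →
      a₁ ≠ a₂ → a₁ ≠ b₁ → a₁ ≠ b₂ → a₂ ≠ b₁ → a₂ ≠ b₂ → b₁ ≠ b₂ →
      (∀ j l : Fin 2, a₁ ≠ eta K j l ∧ a₂ ≠ eta K j l ∧ b₁ ≠ eta K j l ∧ b₂ ≠ eta K j l) →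
      ((∃ M : Surface K → ℂ, IsElementary B₁ B₂ A₁ A₂ M) ↔
        upsilon A₂ / ((a₂ - b₁) * (a₂ - b₂)) + upsilon B₁ / ((a₂ - b₁) * (b₁ - b₂))
            + upsilon B₂ / ((a₂ - b₂) * (b₂ - b₁)) =
          upsilon A₁ / ((a₁ - b₁) * (a₁ - b₂)) + upsilon B₁ / ((a₁ - b₁) * (b₁ - b₂))
            + upsilon B₂ / ((a₁ - b₂) * (b₂ - b₁)))) ∧
    -- double pole and two zeros with different affixes
    (∀ (A₁ A₂ B : Surface K) (a₁ a₂ b : ℂ),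
      affix A₁ = (a₁ : OnePoint ℂ) → affix A₂ = (a₂ : OnePoint ℂ) →
      affix B = (b : OnePoint ℂ) →
      a₁ ≠ b → a₂ ≠ b → a₁ ≠ a₂ →
      (∀ j l : Fin 2, a₁ ≠ eta K j l ∧ a₂ ≠ eta K j l ∧ b ≠ eta K j l) →
      ((∃ M : Surface K → ℂ, IsElementary B B A₁ A₂ M) ↔
        upsilon A₁ / (a₁ - b) ^ 2 + upsilon B / (a₁ - b) ^ 2 + upsilonDot B / (a₁ - b) =
          upsilon A₂ / (a₂ - b) ^ 2 + upsilon B / (a₂ - b) ^ 2 + upsilonDot B / (a₂ - b))) := by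
  have hη := eta_injective hKre hKim
  have hbr : ∀ j l : Fin 2, (0 : ℂ) ^ 2 = quartic K (eta K j l) := fun j l => by
    rw [quartic_eta]; norm_num
  refine ⟨fun j l A₁ A₂ hA => ?_, fun j l B₁ B₂ b hB₁ hB₂ hne hb => ?_,
    fun A₁ A₂ B₁ B₂ a₁ a₂ b₁ b₂ hA₁ hA₂ hB₁ hB₂ h1 h2 h3 h4 h5 h6 hnb => ?_,
    fun A₁ A₂ B a₁ a₂ b hA₁ hA₂ hB h1 h2 h3 hnb => ?_⟩
  · refine elementary_branch hη (hbr j l) fun e => ?_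
    obtain ⟨j', l', hjl, e'⟩ := hA e
    exact ⟨eta K j' l', hbr j' l', hη.ne hjl, e'⟩
  · obtain ⟨β, hβ, rfl⟩ := exists_fin_of_affix hB₁
    obtain ⟨β', hβ', rfl⟩ := exists_fin_of_affix hB₂
    have hs : β' = β ∨ β' = -β := sq_eq_sq_iff_eq_or_eq_neg.1 (by rw [hβ, hβ'])
    obtain rfl : β' = -β := hs.resolve_left fun e => hne (fin_congr rfl e.symm)
    exact exists_isElementary_iff_conj hη (hbr j l) hβ hβ' (hb j l).symm (ne_zero_of_sq hβ hb)
  · obtain ⟨α₁, hα₁, rfl⟩ := exists_fin_of_affix hA₁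
    obtain ⟨α₂, hα₂, rfl⟩ := exists_fin_of_affix hA₂
    obtain ⟨β₁, hβ₁, rfl⟩ := exists_fin_of_affix hB₁
    obtain ⟨β₂, hβ₂, rfl⟩ := exists_fin_of_affix hB₂
    exact exists_isElementary_iff_of_ne hη hα₁ hα₂ hβ₁ hβ₂ h1 h2 h3 h4 h5 h6
      (ne_zero_of_sq hβ₁ fun j l => (hnb j l).2.2.1) (ne_zero_of_sq hβ₂ fun j l => (hnb j l).2.2.2)
  · obtain ⟨α₁, hα₁, rfl⟩ := exists_fin_of_affix hA₁
    obtain ⟨α₂, hα₂, rfl⟩ := exists_fin_of_affix hA₂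
    obtain ⟨β, hβ, rfl⟩ := exists_fin_of_affix hB
    exact exists_isElementary_iff_double hη hα₁ hα₂ hβ h1 h2 h3
      (ne_zero_of_sq hβ fun j l => (hnb j l).2.2)
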